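/- Let $N\ge 2$ and $m\ge 1$ be integers. Let $k_0\colon[0,\infty)\to[0,\infty]$ be monotone decreasing with $$\int_0^\infty \min\{1,r^2\}\,k_0(r)\,r^{N-1}\,dr<\infty,\qquad \int_0^\infty k_0(r)\,r^{N-1}\,dr=\infty,$$ put $k(z)=k_0(|z|)$ for $z\in\mathbb R^N$, and $$\mathcal E_k(u,v)=\frac12\int_{\mathbb R^N}\int_{\mathbb R^N}(u(x)-u(y))(v(x)-v(y))\,k(x-y)\,dy\,dx .$$ Let $\Omega\subset\mathbb R^N$ be a bounded radial domain (nonempty, open, connected, rotation invariant), and let $\mathcal D_k(\Omega)$ be the space of all $u\in L^2(\mathbb R^N)$ with $u=0$ on $\mathbb R^N\setminus\Omega$ and $\mathcal E_k(u,u)<\infty$. Let $I$ be the nonlocal operator associated with $\mathcal E_k$. Functions $u_1,\dots,u_m$ are a weak solution of $$Iu_i=f_i(|x|,u_1,\dots,u_m)\ \text{ in }\Omega,\qquad u_i=0\ \text{ in }\mathbb R^N\setminus\Omega,\qquad i=1,\dots,m, \tag{S}$$ if, for every $i$, $u_i\in\mathcal D_k(\Omega)$ and $\mathcal E_k(u_i,\varphi)=\int_\Omega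 f_i(|x|,u_1(x),\dots,u_m(x))\,\varphi(x)\,dx$ for all $\varphi\in\mathcal D_k(\Omega)$. **Theorem 1.2.** Let $f_1,\dots,f_m\in C^1([0,\infty)\times\mathbb R^m)$ be real-valued functions of $(r,u_1,\dots,u_m)$ with $$\frac{\partial f_j}{\partial u_i}>0\quad\text{on }(0,\infty)^{m+1}\quad\text{for all } i,j\in\{1,\dots,m\},\ i\ne j.$$ Let $u_1,\dots,u_m\colon\mathbb R^N\to\mathbb R$ be continuous bounded functions that are a weak solution of (S), with $u_i>0$ in $\Omega$ for $i=1,\dots,m$. Assume that $$u_i(x_1,x')\ge u_i(-x_1,x')\quad\text{for all }x_1>0,\ x'\in\mathbb R^{N-1},\ i=1,\dots,m,$$ and that there are $x_1>0$, $x'\in\mathbb R^{N-1}$ with $u_1(x_1,x')>u_1(-x_1,x')$. Then there is a unit vector $p\in\mathbb R^N$ such that each of $u_1,\dots,u_m$ is 1. foliated Schwarz symmetric in $\Omega$ with respect to $p$: for every $r>0$ with $r\,S^{N-1}\subset\Omega$ and every $c\in\mathbb R$, the set $\{x\in r\,S^{N-1}: u_i(x)\ge c\}$ is all of $r\,S^{N-1}$,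 or empty, or a closed geodesic ball (possibly of radius $0$) in $r\,S^{N-1}$ centred at $rp$; and 2. strictly decreasing in the polar angle: for every $r>0$ with $r\,S^{N-1}\subset\Omega$ and all $x,y\in r\,S^{N-1}$ with $\arccos(\tfrac{x}{|x|}\cdot p)<\arccos(\tfrac{y}{|y|}\cdot p)$, one has $u_i(x)>u_i(y)$. -/

import Mathlib

open Set MeasureTheory
open scoped ENNReal

noncomputable section

namespace FoliatedSystems

/-- Admissible radial profiles `k₀ : [0,∞) → [0,∞]` in dimension `N` (only the values on `[0,∞)`
matter): `k₀` is monotone decreasing, `∫₀^∞ min{1,r²} k₀(r) r^{N-1} dr < ∞` and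
`∫₀^∞ k₀(r) r^{N-1} dr = ∞`. The kernel itself is `k(z) = k₀(|z|)`. -/
structure IsKernelProfile (N : ℕ) (k₀ : ℝ → ℝ≥0∞) : Prop where
  antitoneOn : AntitoneOn k₀ (Ici 0)
  lintegral_min_lt_top :
    ∫⁻ r in Ioi (0 : ℝ), ENNReal.ofReal (min 1 (r ^ 2)) * k₀ r * ENNReal.ofReal (r ^ (N - 1)) < ∞
  lintegral_eq_top :
    ∫⁻ r in Ioi (0 : ℝ), k₀ r * ENNReal.ofReal (r ^ (N - 1)) = ∞

/-- Twice the energy `𝓔_k(u,u)`, as an element of `[0,∞]`: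
`∫∫ (u(x) - u(y))² k(x - y) dy dx`. -/
def energyENN {N : ℕ} (k₀ : ℝ → ℝ≥0∞) (u : EuclideanSpace ℝ (Fin N) → ℝ) : ℝ≥0∞ :=
  ∫⁻ x, ∫⁻ y, ENNReal.ofReal ((u x - u y) ^ 2) * k₀ ‖x - y‖

/-- The bilinear form
`𝓔_k(u,v) = ½ ∫∫ (u(x) - u(y)) (v(x) - v(y)) k(x - y) dy dx`.
For an admissible profile, `k` is finite off the origin, so `toReal` alters the integrand only on
the diagonal; for `u`, `v` of finite energy the integrand is absolutely integrable. -/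
def bilin {N : ℕ} (k₀ : ℝ → ℝ≥0∞) (u v : EuclideanSpace ℝ (Fin N) → ℝ) : ℝ :=
  (1 / 2 : ℝ) * ∫ x, ∫ y, (u x - u y) * (v x - v y) * (k₀ ‖x - y‖).toReal

/-- Membership in `𝓓_k(Ω)`: functions in `L²(ℝᴺ)` that vanish outside `Ω` and have finite
energy. -/
structure MemD {N : ℕ} (k₀ : ℝ → ℝ≥0∞) (Ω : Set (EuclideanSpace ℝ (Fin N)))
    (u : EuclideanSpace ℝ (Fin N) → ℝ) : Prop where
  memLp : MemLp u 2 volume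
  eq_zero : ∀ x, x ∉ Ω → u x = 0
  energy_lt_top : energyENN k₀ u < ∞

/-- `u₁, …, u_m` is a weak solution of `I u_i = f_i(|x|, u₁, …, u_m)` in `Ω`,
`u_i = 0` in `ℝᴺ ∖ Ω`, `i = 1, …, m`. -/
def IsWeakSolution {N m : ℕ} (k₀ : ℝ → ℝ≥0∞) (Ω : Set (EuclideanSpace ℝ (Fin N)))
    (f : Fin m → ℝ × (Fin m → ℝ) → ℝ) (u : Fin m → EuclideanSpace ℝ (Fin N) → ℝ) : Prop :=
  ∀ i, MemD k₀ Ω (u i) ∧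
    ∀ φ : EuclideanSpace ℝ (Fin N) → ℝ, MemD k₀ Ω φ →
      bilin k₀ (u i) φ = ∫ x in Ω, f i (‖x‖, fun j => u j x) * φ x

/-- A set is radial if membership of a point depends only on its norm. -/
def IsRadial {N : ℕ} (Ω : Set (EuclideanSpace ℝ (Fin N))) : Prop :=
  ∀ x y : EuclideanSpace ℝ (Fin N), ‖x‖ = ‖y‖ → x ∈ Ω → y ∈ Ω

/-- The partial derivative `∂g/∂u_i` of `g = g(r, u₁, …, u_m)` at `(r, u)`. -/
def partialU {m : ℕ} (g : ℝ × (Fin m → ℝ) → ℝ) (i : Fin m) (r : ℝ) (u : Fin m → ℝ) : ℝ :=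
  deriv (fun t : ℝ => g (r, Function.update u i t)) (u i)

/-- The reflection `(x₁, x') ↦ (-x₁, x')`. -/
def flipFirst {N : ℕ} [NeZero N] (x : EuclideanSpace ℝ (Fin N)) : EuclideanSpace ℝ (Fin N) :=
  WithLp.toLp 2 (Function.update x.ofLp 0 (-(x 0)))

/-- The (closed) geodesic ball of radius `ρ` and centre `q` in the sphere `r S^{N-1}`, on which the
geodesic distance of two points is `r` times the angle between them. -/
def geodesicBall {N : ℕ} (r : ℝ) (q : EuclideanSpace ℝ (Fin N)) (ρ : ℝ) :
    Set (EuclideanSpace ℝ (Fin N)) :=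
  {x | ‖x‖ = r ∧ r * InnerProductGeometry.angle x q ≤ ρ}

/-- `u` is foliated Schwarz symmetric in `Ω` with respect to `p`: for every `r > 0` with
`r e₁ ∈ Ω` and every `c`, the set `{x ∈ r S^{N-1} : u(x) ≥ c}` is the whole sphere `r S^{N-1}` or a
geodesic ball in it centred at `r p` (the empty set, which occurs for large `c`, is
counted as a ball). -/
def FoliatedSchwarzSymmetric {N : ℕ} [NeZero N] (Ω : Set (EuclideanSpace ℝ (Fin N)))
    (p : EuclideanSpace ℝ (Fin N)) (u : EuclideanSpace ℝ (Fin N) → ℝ) : Prop :=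
  ∀ r : ℝ, 0 < r → r • (EuclideanSpace.single 0 1 : EuclideanSpace ℝ (Fin N)) ∈ Ω → ∀ c : ℝ,
    {x : EuclideanSpace ℝ (Fin N) | ‖x‖ = r ∧ c ≤ u x} = {x | ‖x‖ = r} ∨
    {x : EuclideanSpace ℝ (Fin N) | ‖x‖ = r ∧ c ≤ u x} = ∅ ∨
    ∃ ρ : ℝ, 0 ≤ ρ ∧
      {x : EuclideanSpace ℝ (Fin N) | ‖x‖ = r ∧ c ≤ u x} = geodesicBall r (r • p) ρ

/-- `u` is strictly decreasing in `Ω` in the polar angle `θ = arccos((x/|x|) · p)`: on each sphere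
`r S^{N-1}` contained in `Ω`, a point of larger polar angle has a strictly smaller value. -/
def StrictlyDecreasingInPolarAngle {N : ℕ} [NeZero N] (Ω : Set (EuclideanSpace ℝ (Fin N)))
    (p : EuclideanSpace ℝ (Fin N)) (u : EuclideanSpace ℝ (Fin N) → ℝ) : Prop :=
  ∀ r : ℝ, 0 < r → r • (EuclideanSpace.single 0 1 : EuclideanSpace ℝ (Fin N)) ∈ Ω →
    ∀ x y : EuclideanSpace ℝ (Fin N), ‖x‖ = r → ‖y‖ = r →
      InnerProductGeometry.angle x p < InnerProductGeometry.angle y p → u y < u x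

end FoliatedSystems

end

/-! For `e ≠ 0` write `x̄` for the reflection of `x` at the hyperplane orthogonal to `e`, and
`w_i(x) = u_i(x) - u_i(x̄)` (`mirrorDiff`). Call `e` dominating if every `w_i` is positive on the
half of `Ω` where `x·e > 0`. It suffices that the dominating directions contain an open half space
`{p·e > 0}`. Indeed, if `|x| = |y|` and `y·p < x·p`, then reflection along `x - y` swaps `x` and
`y`, so `u_i(y) < u_i(x)`; the case `y·p = x·p` is a limit of dominating directions and forces equal
values.

The axis is the first moment `q = ∫ u_0(x) x dx`. From `2 q·e = ∫ w_0(x) (x·e) dx`, dominating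
directions lie in `{q·e > 0}`. In this connected half space they form an open set, by a weak maximum
principle for small sets (`mirrorDiff_nonneg_of_small`). They also form a relatively closed one: in
a limit `w_i ≥ 0`, the condition `q·e > 0` excludes `w_0 ≡ 0`, and the strong maximum principle
(`mirrorDiff_pos`) restores strictness. The first coordinate direction is dominating by hypothesis
and the strong principle, so the set is the whole half space (`mem_dominating_of_inner_moment_pos`).

Both principles rest on folding the form over pairs `(x, y)`, `(x, ȳ)`: for odd functions the
effective kernel `K|x - y| - K|x - ȳ|` is nonnegative for points on the same side. Hence the odd
extension `φ` of the negative part of `w` satisfies `E(φ, φ) ≤ -E(w, φ)` (`form_oddNegPart_le`),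
while cooperativity bounds the reflected right-hand side below by `-L (|w_i| + Σ_j w_j⁻)`.
Non-integrability of the kernel enters twice: it yields a Poincaré inequality with arbitrarily large
constant on sets of small measure, and it makes `K` unbounded at `0`, which drives the barrier in
`eventually_eq_zero_of_supersolution`. Strict coupling passes positivity from one component to all.
-/

namespace FoliatedSystems

/-! ### Kernel profiles -/

/-- The real-valued properties of a kernel profile that the maximum principles use. -/
structure RealProfile (N : ℕ) (K : ℝ → ℝ) : Prop where
  nonneg : ∀ r, 0 ≤ K r
  anti : AntitoneOn K (Ioi 0)
  meas : Measurable fun z : EuclideanSpace ℝ (Fin N) => K ‖z‖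
  integrable_min : Integrable fun z : EuclideanSpace ℝ (Fin N) => min 1 (‖z‖ ^ 2) * K ‖z‖
  not_integrable : ¬ Integrable fun z : EuclideanSpace ℝ (Fin N) => K ‖z‖

/-- By monotonicity an infinite value at `r` would spread to all of `(0, r)`, where the weight is
positive, and the truncated integral would diverge. -/
lemma IsKernelProfile.ne_top {N : ℕ} {k₀ : ℝ → ℝ≥0∞} (hk : IsKernelProfile N k₀) {r : ℝ}
    (hr : 0 < r) : k₀ r ≠ ∞ := by
  intro htop
  have h1 : ∀ s ∈ Ioo 0 r, k₀ s = ∞ := fun s hs =>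
    top_le_iff.1 (htop ▸ hk.antitoneOn hs.1.le hr.le hs.2.le)
  have h2 : (∫⁻ _ in Ioo (0 : ℝ) r, ∞) ≤ ∫⁻ s in Ioi (0 : ℝ),
      ENNReal.ofReal (min 1 (s ^ 2)) * k₀ s * ENNReal.ofReal (s ^ (N - 1)) := by
    refine le_trans ?_ (lintegral_mono_set (s := Ioo 0 r) Ioo_subset_Ioi_self)
    refine setLIntegral_mono' measurableSet_Ioo fun s hs => ?_
    have ha : ENNReal.ofReal (min 1 (s ^ 2)) ≠ 0 := by
      exact (ENNReal.ofReal_pos.2 (lt_min one_pos (pow_pos hs.1 2))).ne'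
    have hb : ENNReal.ofReal (s ^ (N - 1)) ≠ 0 := by
      exact (ENNReal.ofReal_pos.2 (pow_pos hs.1 _)).ne'
    rw [h1 s hs, ENNReal.mul_top ha, ENNReal.top_mul hb]
  have h3 := lt_of_le_of_lt h2 hk.lintegral_min_lt_top
  simp [ENNReal.top_mul, hr] at h3

/-- Only the values on `[0, ∞)` are controlled; cutting off the argument gives a globally antitone,
hence measurable, function. -/
lemma IsKernelProfile.measurable_max {N : ℕ} {k₀ : ℝ → ℝ≥0∞} (hk : IsKernelProfile N k₀) :
    Measurable fun r : ℝ => k₀ (max r 0) := by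
  have : Antitone fun r : ℝ => k₀ (max r 0) := fun a b hab =>
    hk.antitoneOn (mem_Ici.2 (le_max_right _ _)) (mem_Ici.2 (le_max_right _ _))
      (max_le_max_right 0 hab)
  exact this.measurable

/-- Polar coordinates translate the radial conditions. `toReal` loses only a possible infinite value
at the origin, which becomes `0`; this is why monotonicity is kept on `Ioi 0` only. -/
lemma IsKernelProfile.realProfile {N : ℕ} [NeZero N] {k₀ : ℝ → ℝ≥0∞}
    (hk : IsKernelProfile N k₀) : RealProfile N fun r => (k₀ r).toReal := by
  have hm := hk.measurable_max
  have hmn : Measurable fun z : EuclideanSpace ℝ (Fin N) => k₀ ‖z‖ := by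
    have := hm.comp (measurable_norm (α := EuclideanSpace ℝ (Fin N)))
    simpa [Function.comp_def] using this
  have hmi : AEMeasurable k₀ (volume.restrict (Ioi 0)) := by
    refine hm.aemeasurable.congr ?_
    filter_upwards [ae_restrict_mem measurableSet_Ioi] with r hr
    rw [max_eq_left (le_of_lt hr)]
  have hae : ∀ᵐ r ∂(volume.restrict (Ioi (0 : ℝ))), 0 < r ∧ k₀ r ≠ ∞ := by
    filter_upwards [ae_restrict_mem measurableSet_Ioi] with r hr using ⟨hr, hk.ne_top hr⟩
  have hdim : Module.finrank ℝ (EuclideanSpace ℝ (Fin N)) = N := by simp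
  refine ⟨fun r => ENNReal.toReal_nonneg, ?_, hmn.ennreal_toReal, ?_, ?_⟩
  · intro a ha b hb hab
    exact ENNReal.toReal_mono (hk.ne_top ha) 
      (hk.antitoneOn (mem_Ici.2 (le_of_lt ha)) (mem_Ici.2 (le_of_lt hb)) hab)
  · rw [integrable_fun_norm_addHaar (μ := volume) (E := EuclideanSpace ℝ (Fin N))
      (f := fun r => min 1 (r ^ 2) * (k₀ r).toReal), hdim]
    refine ⟨?_, ?_⟩
    · have h1 : AEMeasurable (fun r => (k₀ r).toReal) (volume.restrict (Ioi 0)) :=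
        hmi.ennreal_toReal
      exact (AEMeasurable.mul (by fun_prop) (AEMeasurable.mul (by fun_prop) h1)).aestronglyMeasurable
    · rw [hasFiniteIntegral_iff_enorm]
      refine lt_of_le_of_lt (le_of_eq (lintegral_congr_ae ?_)) hk.lintegral_min_lt_top
      filter_upwards [hae] with r hr
      have h0 : 0 ≤ r ^ (N - 1) := pow_nonneg hr.1.le _
      have h2 : 0 ≤ min 1 (r ^ 2) := le_min zero_le_one (sq_nonneg r)
      rw [Real.enorm_eq_ofReal (by positivity), smul_eq_mul, ENNReal.ofReal_mul h0,
        ENNReal.ofReal_mul h2, ENNReal.ofReal_toReal hr.2, mul_comm]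
  · intro hi
    rw [integrable_fun_norm_addHaar (μ := volume) (E := EuclideanSpace ℝ (Fin N))
      (f := fun r => (k₀ r).toReal), hdim] at hi
    have h := hi.2
    rw [hasFiniteIntegral_iff_enorm] at h
    refine absurd hk.lintegral_eq_top (ne_of_lt (lt_of_le_of_lt (le_of_eq (lintegral_congr_ae ?_)) h))
    filter_upwards [hae] with r hr
    have h0 : 0 ≤ r ^ (N - 1) := pow_nonneg hr.1.le _
    rw [Real.enorm_eq_ofReal (by positivity), smul_eq_mul, ENNReal.ofReal_mul h0,
      ENNReal.ofReal_toReal hr.2, mul_comm]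

namespace RealProfile

variable {N : ℕ} {K : ℝ → ℝ}

/-- A kernel profile is unbounded at the origin. -/
lemma exists_large (hK : RealProfile N K) (M : ℝ) {d : ℝ} (hd : 0 < d) :
    ∃ s, 0 < s ∧ s < d ∧ M ≤ K s := by
  by_contra! hcon
  apply hK.not_integrable
  have hM : ∀ r, 0 < r → r < min d 1 → K r ≤ M := fun r h0 h1 =>
    (hcon r h0 (h1.trans_le (min_le_left _ _))).le
  set c := min d 1
  have hc : 0 < c := lt_min hd one_pos
  have hc1 : c ≤ 1 := min_le_right _ _
  -- The value at the origin is not governed by monotonicity and enters the bound separately.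
  set M' := max M (K 0) with hM'
  have hM0 : 0 ≤ M' := (hK.nonneg 0).trans (le_max_right _ _)
  -- Inside the ball `M'` dominates `K`; outside, `c ^ 2 ≤ min 1 (‖z‖ ^ 2)`, so the second summand
  -- does.
  have hint : Integrable fun z : EuclideanSpace ℝ (Fin N) =>
      (Metric.ball 0 c).indicator (fun _ => M') z
        + (c ^ 2)⁻¹ * (min 1 (‖z‖ ^ 2) * K ‖z‖) := by
    refine Integrable.add ?_ (hK.integrable_min.const_mul _)
    rw [integrable_indicator_iff Metric.isOpen_ball.measurableSet]
    exact integrableOn_const Metric.isBounded_ball.measure_lt_top.ne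
  refine hint.mono' hK.meas.aestronglyMeasurable (Filter.Eventually.of_forall fun z => ?_)
  rw [Real.norm_of_nonneg (hK.nonneg _)]
  have hmin : 0 ≤ min 1 (‖z‖ ^ 2) := le_min zero_le_one (sq_nonneg _)
  by_cases hz : ‖z‖ < c
  · rw [indicator_of_mem (by simpa using hz)]
    have : K ‖z‖ ≤ M' := by
      rcases (norm_nonneg z).eq_or_lt with h | h
      · rw [← h]; exact le_max_right _ _
      · exact (hM _ h hz).trans (le_max_left _ _)
    have := mul_nonneg (inv_nonneg.2 (sq_nonneg c)) (mul_nonneg hmin (hK.nonneg ‖z‖))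
    linarith
  · rw [indicator_of_notMem (by simpa using hz), zero_add]
    push Not at hz
    have h1 : c ^ 2 ≤ min 1 (‖z‖ ^ 2) := le_min (by nlinarith) (by gcongr)
    have h2 : c ^ 2 * K ‖z‖ ≤ min 1 (‖z‖ ^ 2) * K ‖z‖ :=
      mul_le_mul_of_nonneg_right h1 (hK.nonneg _)
    rw [inv_mul_eq_div, le_div_iff₀ (by positivity)]
    linarith

end RealProfile

/-! ### The energy form and functions of finite energy -/

/-- Euclidean space of dimension `N`. -/
abbrev Space (N : ℕ) := EuclideanSpace ℝ (Fin N)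

/-- Reflection at the hyperplane orthogonal to `e`. -/
noncomputable abbrev mirror {N : ℕ} (e : Space N) : Space N ≃ₗᵢ[ℝ] Space N := (Submodule.span ℝ {e})ᗮ.reflection

/-- The form `∫∫ (u(x) - u(y)) (v(x) - v(y)) K(|x - y|) dx dy`. -/
noncomputable def form {N : ℕ} (K : ℝ → ℝ) (u v : Space N → ℝ) : ℝ :=
  ∫ p : Space N × Space N, (u p.1 - u p.2) * (v p.1 - v p.2) * K ‖p.1 - p.2‖

/-- Measurable functions of finite energy. -/
structure FinEnergy {N : ℕ} (K : ℝ → ℝ) (u : Space N → ℝ) : Prop where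
  meas : Measurable u
  integrable : Integrable fun p : Space N × Space N => (u p.1 - u p.2) ^ 2 * K ‖p.1 - p.2‖

section form

variable {N : ℕ} {K : ℝ → ℝ} {u v w : Space N → ℝ}

lemma RealProfile.meas_sub (hK : RealProfile N K) :
    Measurable fun p : Space N × Space N => K ‖p.1 - p.2‖ :=
  hK.meas.comp (measurable_fst.sub measurable_snd)

lemma FinEnergy.meas_diff (hu : FinEnergy K u) :
    Measurable fun p : Space N × Space N => u p.1 - u p.2 :=
  (hu.meas.comp measurable_fst).sub (hu.meas.comp measurable_snd)

lemma FinEnergy.integrable_mul (hK : RealProfile N K) (hu : FinEnergy K u) (hv : FinEnergy K v) :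
    Integrable fun p : Space N × Space N =>
      (u p.1 - u p.2) * (v p.1 - v p.2) * K ‖p.1 - p.2‖ := by
  refine (hu.integrable.add hv.integrable).mono'
    ((hu.meas_diff.mul hv.meas_diff).mul hK.meas_sub).aestronglyMeasurable
    (Filter.Eventually.of_forall fun p => ?_)
  have hk := hK.nonneg ‖p.1 - p.2‖
  simp only [Pi.add_apply]
  rw [norm_mul, Real.norm_of_nonneg hk, ← add_mul, Real.norm_eq_abs]
  refine mul_le_mul_of_nonneg_right ?_ hk
  rw [abs_le]
  constructor <;> nlinarith [sq_nonneg (u p.1 - u p.2 + (v p.1 - v p.2)),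
    sq_nonneg (u p.1 - u p.2 - (v p.1 - v p.2)), sq_nonneg (u p.1 - u p.2),
    sq_nonneg (v p.1 - v p.2)]

lemma FinEnergy.sub (hK : RealProfile N K) (hu : FinEnergy K u) (hv : FinEnergy K v) :
    FinEnergy K fun x => u x - v x := by
  refine ⟨hu.meas.sub hv.meas, ?_⟩
  have := (hu.integrable.sub ((hu.integrable_mul hK hv).const_mul 2)).add hv.integrable
  refine this.congr (Filter.Eventually.of_forall fun p => ?_)
  simp only [Pi.add_apply, Pi.sub_apply]
  ring

lemma FinEnergy.const_mul (hu : FinEnergy K u) (c : ℝ) : FinEnergy K fun x => c * u x := by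
  refine ⟨hu.meas.const_mul c, ?_⟩
  refine (hu.integrable.const_mul (c ^ 2)).congr (Filter.Eventually.of_forall fun p => ?_)
  simp only
  ring

lemma FinEnergy.add (hK : RealProfile N K) (hu : FinEnergy K u) (hv : FinEnergy K v) :
    FinEnergy K fun x => u x + v x := by
  simpa using hu.sub hK (hv.const_mul (-1))

lemma form_sub_left (hK : RealProfile N K) (hu : FinEnergy K u) (hv : FinEnergy K v)
    (hw : FinEnergy K w) : form K (fun x => u x - v x) w = form K u w - form K v w := by
  unfold form
  rw [← integral_sub (hu.integrable_mul hK hw) (hv.integrable_mul hK hw)]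
  congr 1; ext p; ring

lemma form_add_left (hK : RealProfile N K) (hu : FinEnergy K u) (hv : FinEnergy K v)
    (hw : FinEnergy K w) : form K (fun x => u x + v x) w = form K u w + form K v w := by
  unfold form
  rw [← integral_add (hu.integrable_mul hK hw) (hv.integrable_mul hK hw)]
  congr 1; ext p; ring

lemma form_const_mul_left (c : ℝ) : form K (fun x => c * u x) w = c * form K u w := by
  unfold form
  rw [← integral_const_mul]
  congr 1; ext p; ring

lemma form_self_nonneg (hK : RealProfile N K) : 0 ≤ form K u u :=
  integral_nonneg fun _ => mul_nonneg (mul_self_nonneg _) (hK.nonneg _)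

lemma measurePreserving_isometry (σ : Space N ≃ₗᵢ[ℝ] Space N) :
    MeasurePreserving (Prod.map σ σ) (volume : Measure (Space N × Space N)) volume :=
  σ.measurePreserving.prod σ.measurePreserving

lemma measurableEmbedding_isometry (σ : Space N ≃ₗᵢ[ℝ] Space N) :
    MeasurableEmbedding (Prod.map σ σ) :=
  σ.toHomeomorph.measurableEmbedding.prodMap σ.toHomeomorph.measurableEmbedding

lemma FinEnergy.comp_isometry (hu : FinEnergy K u) (σ : Space N ≃ₗᵢ[ℝ] Space N) :
    FinEnergy K fun x => u (σ x) := by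
  refine ⟨hu.meas.comp σ.continuous.measurable, ?_⟩
  have := ((measurePreserving_isometry σ).integrable_comp_emb
    (measurableEmbedding_isometry σ)).2 hu.integrable
  refine this.congr (Filter.Eventually.of_forall fun p => ?_)
  simp [← map_sub]

lemma form_comp_isometry (u v : Space N → ℝ) (σ : Space N ≃ₗᵢ[ℝ] Space N) :
    form K (fun x => u (σ x)) (fun x => v (σ x)) = form K u v := by
  unfold form
  refine Eq.trans ?_ ((measurePreserving_isometry σ).integral_comp (measurableEmbedding_isometry σ) _)
  congr 1; ext p
  simp [← map_sub]

end form

/-! ### Folding the form for odd functions -/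

section pairing

variable {N : ℕ} {K : ℝ → ℝ} {u v : Space N → ℝ} {σ : Space N ≃ₗᵢ[ℝ] Space N}

lemma measurePreserving_snd (σ : Space N ≃ₗᵢ[ℝ] Space N) :
    MeasurePreserving (Prod.map id σ) (volume : Measure (Space N × Space N)) volume :=
  (MeasurePreserving.id _).prod σ.measurePreserving

lemma measurableEmbedding_snd (σ : Space N ≃ₗᵢ[ℝ] Space N) :
    MeasurableEmbedding (Prod.map (id : Space N → Space N) σ) :=
  MeasurableEmbedding.id.prodMap σ.toHomeomorph.measurableEmbedding

lemma integrable_flip (hK : RealProfile N K) (hu : FinEnergy K u) (hv : FinEnergy K v)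
    (hua : ∀ x, u (σ x) = -u x) (hva : ∀ x, v (σ x) = -v x) :
    Integrable fun p : Space N × Space N =>
      (u p.1 + u p.2) * (v p.1 + v p.2) * K ‖p.1 - σ p.2‖ := by
  have := ((measurePreserving_snd σ).integrable_comp_emb
    (measurableEmbedding_snd σ)).2 (hu.integrable_mul hK hv)
  refine this.congr (Filter.Eventually.of_forall fun p => ?_)
  simp [hua, hva]

/-- For functions that are odd under an isometry, the form is the mean of the contributions of
`(x, y)` and `(x, σ y)`. -/
lemma form_eq_pairing (hK : RealProfile N K) (hu : FinEnergy K u) (hv : FinEnergy K v)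
    (hua : ∀ x, u (σ x) = -u x) (hva : ∀ x, v (σ x) = -v x) :
    form K u v = (1 / 2) * ∫ p : Space N × Space N,
      ((u p.1 - u p.2) * (v p.1 - v p.2) * K ‖p.1 - p.2‖
        + (u p.1 + u p.2) * (v p.1 + v p.2) * K ‖p.1 - σ p.2‖) := by
  rw [integral_add (hu.integrable_mul hK hv) (integrable_flip hK hu hv hua hva)]
  have h : ∫ p : Space N × Space N, (u p.1 + u p.2) * (v p.1 + v p.2) * K ‖p.1 - σ p.2‖
      = form K u v := by
    unfold form
    refine Eq.trans ?_ ((measurePreserving_snd σ).integral_comp (measurableEmbedding_snd σ) _)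
    congr 1; ext p
    simp [hua, hva]
  rw [h]
  unfold form
  ring

/-- The first summand on the left is already the energy density of `v`, and the right side is
integrable because `u` is odd. Oddness of `v` plays no role. -/
lemma finEnergy_of_pairing (hK : RealProfile N K) (hu : FinEnergy K u) (hv : Measurable v)
    (hua : ∀ x, u (σ x) = -u x)
    (h : ∀ᵐ p : Space N × Space N, (v p.1 - v p.2) ^ 2 * K ‖p.1 - p.2‖
        + (v p.1 + v p.2) ^ 2 * K ‖p.1 - σ p.2‖ ≤ (u p.1 - u p.2) ^ 2 * K ‖p.1 - p.2‖
        + (u p.1 + u p.2) ^ 2 * K ‖p.1 - σ p.2‖) : FinEnergy K v := by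
  refine ⟨hv, ?_⟩
  have h1 := integrable_flip hK hu hu hua hua
  have h2 := hu.integrable.add h1
  refine h2.mono' ?_ ?_
  · exact ((((hv.comp measurable_fst).sub (hv.comp measurable_snd)).pow_const 2).mul
      hK.meas_sub).aestronglyMeasurable
  · filter_upwards [h] with p hp
    rw [Real.norm_of_nonneg (mul_nonneg (sq_nonneg _) (hK.nonneg _))]
    have := mul_nonneg (sq_nonneg (v p.1 + v p.2)) (hK.nonneg ‖p.1 - σ p.2‖)
    simp only [Pi.add_apply, ← sq]
    linarith

/-- With `σ` the identity this discards the diagonal, with a reflection the pairs `x = ȳ`. There one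
of the two distances is zero and monotonicity of `K` says nothing. -/
lemma ae_fst_ne_snd [NeZero N] (σ : Space N ≃ₗᵢ[ℝ] Space N) :
    ∀ᵐ p : Space N × Space N, p.1 ≠ σ p.2 := by
  have hm : MeasurableSet {p : Space N × Space N | ¬ p.1 ≠ σ p.2} := by
    simp only [not_not]
    exact (isClosed_eq continuous_fst (σ.continuous.comp continuous_snd)).measurableSet
  have : (volume : Measure (Space N × Space N)) {p | ¬ p.1 ≠ σ p.2} = 0 := by
    rw [Measure.volume_eq_prod, Measure.measure_prod_null hm]
    refine Filter.Eventually.of_forall fun x => ?_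
    have : (Prod.mk x ⁻¹' {p : Space N × Space N | ¬ p.1 ≠ σ p.2}) = {σ.symm x} := by
      ext y
      simp only [ne_eq, not_not, mem_preimage, mem_ofPred_eq, mem_singleton_iff]
      rw [← σ.symm_apply_eq, eq_comm]
    simp only [this, measure_singleton, Pi.zero_apply]
  exact this

end pairing

/-! ### Reflections and the kernel inequality -/

section mirror

variable {N : ℕ} {K : ℝ → ℝ}

lemma mirror_apply (e x : Space N) : mirror e x = x - (2 * inner ℝ e x / ‖e‖ ^ 2) • e := by
  rw [mirror, Submodule.reflection_orthogonal_apply, Submodule.reflection_singleton_apply]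
  simp [two_smul, ← add_smul, two_mul, add_div]

lemma mirror_mirror (e x : Space N) : mirror e (mirror e x) = x :=
  Submodule.reflection_reflection _ _

lemma inner_mirror {e : Space N} (he : e ≠ 0) (x : Space N) :
    inner ℝ (mirror e x) e = -inner ℝ x e := by
  have : ‖e‖ ^ 2 ≠ 0 := by positivity
  rw [mirror_apply, inner_sub_left, inner_smul_left, real_inner_self_eq_norm_sq,
    real_inner_comm e x]
  simp
  field_simp
  ring

lemma mirror_eq_self {e x : Space N} (h : inner ℝ x e = 0) : mirror e x = x := by
  rw [mirror_apply, real_inner_comm, h]; simp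

lemma norm_sub_mirror_sq {e : Space N} (he : e ≠ 0) (x y : Space N) :
    ‖x - mirror e y‖ ^ 2 = ‖x - y‖ ^ 2 + 4 * (inner ℝ x e * inner ℝ y e) / ‖e‖ ^ 2 := by
  have h : ‖e‖ ^ 2 ≠ 0 := by positivity
  have e1 := norm_sub_sq_real x (mirror e y)
  have e2 := norm_sub_sq_real x y
  rw [e1, e2, LinearIsometryEquiv.norm_map, mirror_apply, inner_sub_right, inner_smul_right,
    real_inner_comm y e]
  field_simp
  ring

/-- Points on the same side of the mirror are closer to each other than to their images. -/
lemma RealProfile.mirror_le (hK : RealProfile N K) {e : Space N} (he : e ≠ 0) {x y : Space N}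
    (hxy : x ≠ y) (h : 0 ≤ inner ℝ x e * inner ℝ y e) :
    K ‖x - mirror e y‖ ≤ K ‖x - y‖ := by
  have h0 : 0 < ‖x - y‖ := norm_pos_iff.2 (sub_ne_zero.2 hxy)
  have h1 : ‖x - y‖ ≤ ‖x - mirror e y‖ := by
    rw [← sq_le_sq₀ h0.le (norm_nonneg _), norm_sub_mirror_sq he]
    have : 0 ≤ 4 * (inner ℝ x e * inner ℝ y e) / ‖e‖ ^ 2 := by positivity
    linarith
  exact hK.anti h0 (h0.trans_le h1) h1

lemma RealProfile.le_mirror (hK : RealProfile N K) {e : Space N} (he : e ≠ 0) {x y : Space N}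
    (hxy : x ≠ mirror e y) (h : inner ℝ x e * inner ℝ y e ≤ 0) :
    K ‖x - y‖ ≤ K ‖x - mirror e y‖ := by
  have := hK.mirror_le he hxy (by rw [inner_mirror he]; nlinarith)
  rwa [mirror_mirror] at this

end mirror

/-! ### The odd extension of the negative part -/

section negPart

variable {N : ℕ} {K : ℝ → ℝ} {e : Space N} {z a b : Space N → ℝ}

/-- The negative part of `z` on the half space `{x : 0 < ⟪x, e⟫}`, extended to an odd function. -/
noncomputable def oddNegPart (e : Space N) (z : Space N → ℝ) (x : Space N) : ℝ :=
  if 0 < inner ℝ x e then max (-z x) 0 else if inner ℝ x e < 0 then -max (z x) 0 else 0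

/-- `a` has the same sign as `⟪·, e⟫`. -/
def SignedAlong (e : Space N) (a : Space N → ℝ) : Prop :=
  ∀ x, (0 ≤ inner ℝ x e → 0 ≤ a x) ∧ (inner ℝ x e ≤ 0 → a x ≤ 0)

lemma SignedAlong.mul_nonneg (ha : SignedAlong e a) (hb : SignedAlong e b) (x : Space N) :
    0 ≤ a x * b x := by
  rcases le_total 0 (inner ℝ x e) with h | h
  · exact _root_.mul_nonneg ((ha x).1 h) ((hb x).1 h)
  · exact mul_nonneg_of_nonpos_of_nonpos ((ha x).2 h) ((hb x).2 h)

/-- The product `a x * b y` and the kernel difference both have, weakly, the sign of `⟪x, e⟫ * ⟪y,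
e⟫`. -/
lemma SignedAlong.cross_nonneg [NeZero N] (hK : RealProfile N K) (he : e ≠ 0)
    (ha : SignedAlong e a) (hb : SignedAlong e b) :
    ∀ᵐ p : Space N × Space N, 0 ≤ a p.1 * b p.2 * (K ‖p.1 - p.2‖ - K ‖p.1 - mirror e p.2‖) := by
  filter_upwards [ae_fst_ne_snd (LinearIsometryEquiv.refl ℝ (Space N)), ae_fst_ne_snd (mirror e)]
    with p h1 h2
  simp only [LinearIsometryEquiv.coe_refl, id_eq] at h1
  rcases le_total 0 (inner ℝ p.1 e) with hx | hx <;> rcases le_total 0 (inner ℝ p.2 e) with hy | hy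
  · exact _root_.mul_nonneg (_root_.mul_nonneg ((ha _).1 hx) ((hb _).1 hy))
      (sub_nonneg.2 (hK.mirror_le he h1 (_root_.mul_nonneg hx hy)))
  · exact mul_nonneg_of_nonpos_of_nonpos (mul_nonpos_of_nonneg_of_nonpos ((ha _).1 hx)
      ((hb _).2 hy)) (sub_nonpos.2 (hK.le_mirror he h2 (mul_nonpos_of_nonneg_of_nonpos hx hy)))
  · exact mul_nonneg_of_nonpos_of_nonpos (mul_nonpos_of_nonpos_of_nonneg ((ha _).2 hx)
      ((hb _).1 hy)) (sub_nonpos.2 (hK.le_mirror he h2 (mul_nonpos_of_nonpos_of_nonneg hx hy)))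
  · exact _root_.mul_nonneg (mul_nonneg_of_nonpos_of_nonpos ((ha _).2 hx) ((hb _).2 hy))
      (sub_nonneg.2 (hK.mirror_le he h1 (mul_nonneg_of_nonpos_of_nonpos hx hy)))

lemma odd_eq_zero (hz : ∀ x, z (mirror e x) = -z x) {x : Space N} (hx : inner ℝ x e = 0) :
    z x = 0 := by
  have := hz x
  rw [mirror_eq_self hx] at this
  linarith

lemma measurable_oddNegPart (hz : Measurable z) : Measurable (oddNegPart e z) := by
  have h : Continuous fun x : Space N => inner ℝ x e := by fun_prop
  refine Measurable.ite (isOpen_lt continuous_const h).measurableSet (hz.neg.max measurable_const)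
    (Measurable.ite (isOpen_lt h continuous_const).measurableSet (hz.max measurable_const).neg
      measurable_const)

lemma oddNegPart_of_pos {x : Space N} (hx : 0 < inner ℝ x e) :
    oddNegPart e z x = max (-z x) 0 := if_pos hx

lemma oddNegPart_of_neg {x : Space N} (hx : inner ℝ x e < 0) :
    oddNegPart e z x = -max (z x) 0 := by
  rw [oddNegPart, if_neg hx.not_gt, if_pos hx]

lemma oddNegPart_of_eq {x : Space N} (hx : inner ℝ x e = 0) : oddNegPart e z x = 0 := by
  rw [oddNegPart, if_neg hx.not_gt, if_neg hx.not_lt]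

lemma oddNegPart_mirror (he : e ≠ 0) (hz : ∀ x, z (mirror e x) = -z x) (x : Space N) :
    oddNegPart e z (mirror e x) = -oddNegPart e z x := by
  have hi := inner_mirror he x
  rcases lt_trichotomy (inner ℝ x e) 0 with h | h | h
  · rw [oddNegPart_of_pos (by linarith), oddNegPart_of_neg h, hz, neg_neg, neg_neg]
  · rw [oddNegPart_of_eq (by linarith), oddNegPart_of_eq h, neg_zero]
  · rw [oddNegPart_of_neg (by linarith), oddNegPart_of_pos h, hz]

lemma signedAlong_oddNegPart : SignedAlong e (oddNegPart e z) := by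
  intro x
  rcases lt_trichotomy (inner ℝ x e) 0 with h | h | h
  · rw [oddNegPart_of_neg h]
    exact ⟨fun h' => absurd h h'.not_gt, fun _ => neg_nonpos.2 (le_max_right _ _)⟩
  · rw [oddNegPart_of_eq h]; simp
  · rw [oddNegPart_of_pos h]
    exact ⟨fun _ => le_max_right _ _, fun h' => absurd h h'.not_gt⟩

/-- The sum is the odd extension of the positive part of `z` on the half space. -/
lemma signedAlong_add_oddNegPart (hz : ∀ x, z (mirror e x) = -z x) :
    SignedAlong e fun x => z x + oddNegPart e z x := by
  intro x
  simp only
  rcases lt_trichotomy (inner ℝ x e) 0 with h | h | h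
  · rw [oddNegPart_of_neg h]
    exact ⟨fun h' => absurd h h'.not_gt, fun _ => by linarith [le_max_left (z x) 0]⟩
  · rw [oddNegPart_of_eq h, odd_eq_zero hz h]; simp
  · rw [oddNegPart_of_pos h]
    exact ⟨fun _ => by linarith [le_max_left (-z x) 0], fun h' => absurd h h'.not_gt⟩

lemma oddNegPart_eq_or (e : Space N) (z : Space N → ℝ) (x : Space N) :
    oddNegPart e z x = 0 ∨ oddNegPart e z x = -z x := by
  rcases lt_trichotomy (inner ℝ x e) 0 with h | h | h
  · rw [oddNegPart_of_neg h]
    rcases max_choice (z x) 0 with h' | h' <;> simp [h']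
  · simp [oddNegPart_of_eq h]
  · rw [oddNegPart_of_pos h]
    rcases max_choice (-z x) 0 with h' | h' <;> simp [h']

lemma add_oddNegPart_mul (e : Space N) (z : Space N → ℝ) (x : Space N) :
    (z x + oddNegPart e z x) * oddNegPart e z x = 0 := by
  rcases oddNegPart_eq_or e z x with h | h <;> simp [h]

lemma abs_oddNegPart_le (e : Space N) (z : Space N → ℝ) (x : Space N) :
    |oddNegPart e z x| ≤ |z x| := by
  rcases oddNegPart_eq_or e z x with h | h <;> simp [h]

/-- Let `v = z + φ` with `φ` the odd negative part. The folded density of `z = v - φ` exceeds that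
of `φ` by the folded density of `v` and mixed terms `v(x) φ(y) (J - J')`, all nonnegative; products
at a single point drop out because `v φ = 0`. -/
lemma finEnergy_oddNegPart [NeZero N] (hK : RealProfile N K) (he : e ≠ 0) (hz : FinEnergy K z)
    (hza : ∀ x, z (mirror e x) = -z x) : FinEnergy K (oddNegPart e z) := by
  refine finEnergy_of_pairing hK hz (measurable_oddNegPart hz.meas) hza ?_
  filter_upwards [(signedAlong_add_oddNegPart hza).cross_nonneg hK he (signedAlong_oddNegPart (z := z)),
    (signedAlong_oddNegPart (e := e) (z := z)).cross_nonneg hK he (signedAlong_add_oddNegPart hza)]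
    with p h1 h2
  have hx := add_oddNegPart_mul e z p.1
  have hy := add_oddNegPart_mul e z p.2
  have hJ := hK.nonneg ‖p.1 - p.2‖
  have hJ' := hK.nonneg ‖p.1 - mirror e p.2‖
  generalize K ‖p.1 - p.2‖ = J at *
  generalize K ‖p.1 - mirror e p.2‖ = J' at *
  obtain ⟨v, hv⟩ : ∃ v, v = z p.1 + oddNegPart e z p.1 := ⟨_, rfl⟩
  obtain ⟨v', hv'⟩ : ∃ v, v = z p.2 + oddNegPart e z p.2 := ⟨_, rfl⟩
  rw [← hv] at h1 hx
  rw [← hv'] at h2 hy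
  have e1 : z p.1 = v - oddNegPart e z p.1 := by linarith
  have e2 : z p.2 = v' - oddNegPart e z p.2 := by linarith
  rw [e1, e2]
  generalize oddNegPart e z p.1 = c at *
  generalize oddNegPart e z p.2 = c' at *
  have key : (v - c - (v' - c')) ^ 2 * J + (v - c + (v' - c')) ^ 2 * J'
      - ((c - c') ^ 2 * J + (c + c') ^ 2 * J')
      = (v - v') ^ 2 * J + (v + v') ^ 2 * J' + 2 * (v * c' * (J - J')) + 2 * (c * v' * (J - J'))
        - 2 * (v * c) * (J + J') - 2 * (v' * c') * (J + J') := by ring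
  rw [hx, hy] at key
  have := mul_nonneg (sq_nonneg (v - v')) hJ
  have := mul_nonneg (sq_nonneg (v + v')) hJ'
  linarith

/-- The claim amounts to `form K (z + φ) φ ≤ 0`. After folding, products at a single point vanish
and the mixed ones appear with the sign of `-(J - J')`. -/
lemma form_oddNegPart_le [NeZero N] (hK : RealProfile N K) (he : e ≠ 0) (hz : FinEnergy K z)
    (hza : ∀ x, z (mirror e x) = -z x) :
    form K (oddNegPart e z) (oddNegPart e z) ≤ -form K z (oddNegPart e z) := by
  have hφ := finEnergy_oddNegPart hK he hz hza
  have hφa := oddNegPart_mirror he hza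
  have h1 := form_add_left hK hz hφ hφ
  have hva : ∀ x, (fun x => z x + oddNegPart e z x) (mirror e x)
      = -(fun x => z x + oddNegPart e z x) x := by
    intro x; simp only [hza, hφa]; ring
  have h2 := form_eq_pairing hK (hz.add hK hφ) hφ hva hφa
  have h3 : ∫ p : Space N × Space N,
      ((z p.1 + oddNegPart e z p.1 - (z p.2 + oddNegPart e z p.2)) *
          (oddNegPart e z p.1 - oddNegPart e z p.2) * K ‖p.1 - p.2‖
        + (z p.1 + oddNegPart e z p.1 + (z p.2 + oddNegPart e z p.2)) *
          (oddNegPart e z p.1 + oddNegPart e z p.2) * K ‖p.1 - mirror e p.2‖) ≤ 0 := by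
    refine integral_nonpos_of_ae ?_
    filter_upwards [(signedAlong_add_oddNegPart hza).cross_nonneg hK he (signedAlong_oddNegPart (z := z)),
      (signedAlong_oddNegPart (e := e) (z := z)).cross_nonneg hK he (signedAlong_add_oddNegPart hza)]
      with p h1 h2
    have hx := add_oddNegPart_mul e z p.1
    have hy := add_oddNegPart_mul e z p.2
    simp only [Pi.zero_apply]
    generalize K ‖p.1 - p.2‖ = J at *
    generalize K ‖p.1 - mirror e p.2‖ = J' at *
    generalize oddNegPart e z p.1 = c at *
    generalize oddNegPart e z p.2 = c' at *
    have key : (z p.1 + c - (z p.2 + c')) * (c - c') * J + (z p.1 + c + (z p.2 + c')) * (c + c') * J'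
        = (z p.1 + c) * c * (J + J') + (z p.2 + c') * c' * (J + J')
          - (z p.1 + c) * c' * (J - J') - c * (z p.2 + c') * (J - J') := by ring
    rw [key, hx, hy]
    linarith
  rw [h1] at h2
  linarith

end negPart

/-! ### Poincaré inequality on small sets -/

section poincare

variable {N : ℕ} {K : ℝ → ℝ}

/-- Some truncation `min K n` has integral above `M + 1`, and a set of measure at most `1 / (n + 1)`
removes at most `1` from it. Translation invariance makes this uniform in `x`. -/
lemma RealProfile.lintegral_compl_ge (hK : RealProfile N K) (M : ℝ) :
    ∃ ε : ℝ≥0∞, 0 < ε ∧ ∀ A : Set (Space N), MeasurableSet A → volume A ≤ ε → ∀ x,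
      ENNReal.ofReal M ≤ ∫⁻ y in Aᶜ, ENNReal.ofReal (K ‖x - y‖) := by
  have hinf : ∫⁻ z : Space N, ENNReal.ofReal (K ‖z‖) = ∞ := by
    by_contra h
    refine hK.not_integrable ⟨hK.meas.aestronglyMeasurable, ?_⟩
    rw [hasFiniteIntegral_iff_ofReal (Filter.Eventually.of_forall fun z => hK.nonneg _)]
    exact lt_top_iff_ne_top.2 h
  have hmeas := hK.meas.ennreal_ofReal
  have hsup : ∫⁻ z : Space N, ENNReal.ofReal (K ‖z‖)
      = ⨆ n : ℕ, ∫⁻ z : Space N, min (ENNReal.ofReal (K ‖z‖)) n := by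
    rw [← lintegral_iSup (fun n => hmeas.min measurable_const)]
    · congr 1; ext z
      rw [← inf_iSup_eq, ENNReal.iSup_natCast, inf_top_eq]
    · intro a b hab z
      exact min_le_min_left _ (by exact_mod_cast hab)
  rw [hinf] at hsup
  obtain ⟨n, hn⟩ := lt_iSup_iff.1 (hsup ▸ (ENNReal.add_lt_top.2
    ⟨ENNReal.ofReal_lt_top (r := M), ENNReal.one_lt_top⟩))
  refine ⟨(n + 1 : ℝ≥0∞)⁻¹, by simp, fun A hA hvol x => ?_⟩
  have h1 : ∫⁻ y : Space N, min (ENNReal.ofReal (K ‖x - y‖)) n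
      = ∫⁻ z : Space N, min (ENNReal.ofReal (K ‖z‖)) n :=
    lintegral_sub_left_eq_self (fun z : Space N => min (ENNReal.ofReal (K ‖z‖)) n) x
  rw [← h1, ← lintegral_add_compl _ hA] at hn
  have h2 : ∫⁻ y in A, min (ENNReal.ofReal (K ‖x - y‖)) n ≤ 1 := calc
    _ ≤ ∫⁻ _ in A, (n : ℝ≥0∞) := lintegral_mono fun _ => min_le_right _ _
    _ = n * volume A := by simp
    _ ≤ (n + 1) * (n + 1 : ℝ≥0∞)⁻¹ := by gcongr; simp
    _ ≤ 1 := ENNReal.mul_inv_le_one _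
  have h3 : ∫⁻ y in Aᶜ, min (ENNReal.ofReal (K ‖x - y‖)) n
      ≤ ∫⁻ y in Aᶜ, ENNReal.ofReal (K ‖x - y‖) := lintegral_mono fun _ => min_le_left _ _
  have h4 : ENNReal.ofReal M + 1 ≤ (∫⁻ y in Aᶜ, ENNReal.ofReal (K ‖x - y‖)) + 1 := by
    rw [add_comm _ (1 : ℝ≥0∞)] at hn ⊢
    rw [add_comm _ (1 : ℝ≥0∞)]
    exact hn.le.trans (add_le_add h2 h3)
  exact (ENNReal.add_le_add_iff_right ENNReal.one_ne_top).1 h4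

/-- Poincaré inequality on sets of small measure, with a large constant. -/
lemma RealProfile.poincare (hK : RealProfile N K) (M : ℝ) :
    ∃ ε : ℝ≥0∞, 0 < ε ∧ ∀ A : Set (Space N), MeasurableSet A → volume A ≤ ε →
      ∀ φ : Space N → ℝ, FinEnergy K φ → (∀ x, x ∉ A → φ x = 0) →
        Integrable (fun x => φ x ^ 2) → M * ∫ x, φ x ^ 2 ≤ form K φ φ := by
  obtain ⟨ε, hε, h⟩ := hK.lintegral_compl_ge M
  refine ⟨ε, hε, fun A hA hvol φ hφ hsupp hint => ?_⟩
  have hi := hφ.integrable_mul hK hφ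
  unfold form
  rw [Measure.volume_eq_prod, integral_prod _ hi, ← integral_const_mul]
  refine integral_mono_ae (hint.const_mul M) hi.integral_prod_left ?_
  filter_upwards [hi.prod_right_ae] with x hx
  have hpos : ∀ y, 0 ≤ (φ x - φ y) * (φ x - φ y) * K ‖x - y‖ := fun y =>
    mul_nonneg (mul_self_nonneg _) (hK.nonneg _)
  rw [← ENNReal.ofReal_le_ofReal_iff (integral_nonneg hpos),
    ofReal_integral_eq_lintegral_ofReal hx (Filter.Eventually.of_forall hpos)]
  -- Only the points `y ∉ A` are kept; there the integrand is `φ x ^ 2 * K ‖x - y‖`.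
  calc ENNReal.ofReal (M * φ x ^ 2) = ENNReal.ofReal (φ x ^ 2) * ENNReal.ofReal M := by
        rw [mul_comm, ENNReal.ofReal_mul (sq_nonneg _)]
    _ ≤ ENNReal.ofReal (φ x ^ 2) * ∫⁻ y in Aᶜ, ENNReal.ofReal (K ‖x - y‖) := by
        gcongr; exact h A hA hvol x
    _ = ∫⁻ y in Aᶜ, ENNReal.ofReal (φ x ^ 2) * ENNReal.ofReal (K ‖x - y‖) :=
        (lintegral_const_mul' _ _ ENNReal.ofReal_ne_top).symm
    _ = ∫⁻ y in Aᶜ, ENNReal.ofReal ((φ x - φ y) * (φ x - φ y) * K ‖x - y‖) := by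
        refine setLIntegral_congr_fun hA.compl fun y hy => ?_
        rw [hsupp y hy, sub_zero, ← sq, ENNReal.ofReal_mul (sq_nonneg _)]
    _ ≤ _ := setLIntegral_le_lintegral _ _

end poincare

/-! ### Bumps as test functions and barriers -/

section bump

variable {N : ℕ} {K : ℝ → ℝ}

/-- The truncated paraboloid `max (r² - |x - a|²) 0`. -/
noncomputable def bump {N : ℕ} (a : Space N) (r : ℝ) (x : Space N) : ℝ := max (r ^ 2 - ‖x - a‖ ^ 2) 0

variable {a : Space N} {r : ℝ}

lemma continuous_bump : Continuous (bump a r) := by unfold bump; fun_prop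

lemma bump_nonneg (x : Space N) : 0 ≤ bump a r x := le_max_right _ _

lemma bump_le (x : Space N) : bump a r x ≤ r ^ 2 :=
  max_le (by linarith [sq_nonneg ‖x - a‖]) (sq_nonneg r)

lemma bump_of_le (hr : 0 ≤ r) {x : Space N} (hx : r ≤ ‖x - a‖) : bump a r x = 0 :=
  max_eq_right (by nlinarith)

lemma bump_pos {x : Space N} (hx : ‖x - a‖ < r) : 0 < bump a r x :=
  lt_max_of_lt_left (by nlinarith [norm_nonneg (x - a)])

lemma bump_ne_zero (hr : 0 ≤ r) {x : Space N} (hx : bump a r x ≠ 0) : ‖x - a‖ < r := by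
  by_contra! h
  exact hx (bump_of_le hr h)

lemma abs_bump_sub_le (hr : 0 ≤ r) (x y : Space N) :
    |bump a r x - bump a r y| ≤ 2 * r * ‖x - y‖ := by
  wlog h : ‖x - a‖ ≤ ‖y - a‖ generalizing x y
  · rw [abs_sub_comm, norm_sub_rev]
    exact this y x (le_of_not_ge h)
  have h1 : ‖y - a‖ ≤ ‖x - a‖ + ‖x - y‖ := by
    have := norm_sub_le (x - a) (x - y)
    simpa using this
  have h0 := norm_nonneg (x - a)
  have h2 := norm_nonneg (x - y)
  rcases le_total r ‖x - a‖ with hx | hx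
  · rw [bump_of_le hr hx, bump_of_le hr (hx.trans h), sub_zero, abs_zero]; positivity
  have ex : bump a r x = r ^ 2 - ‖x - a‖ ^ 2 := max_eq_left (by nlinarith)
  rcases le_total r ‖y - a‖ with hy | hy
  · rw [bump_of_le hr hy, sub_zero, abs_of_nonneg (bump_nonneg x), ex]
    nlinarith
  · have ey : bump a r y = r ^ 2 - ‖y - a‖ ^ 2 := max_eq_left (by nlinarith)
    rw [ex, ey, abs_of_nonneg (by nlinarith)]
    nlinarith

/-- Adding `‖x - a‖ ^ 2` to the bump gives the maximum of `r ^ 2` and `‖x - a‖ ^ 2`, a convex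
function. The bound is one-sided because of the kink, and is applied only where the test function is
nonnegative. -/
lemma bump_second_difference_le (x z : Space N) :
    2 * bump a r x - bump a r (x + z) - bump a r (x - z) ≤ 2 * ‖z‖ ^ 2 := by
  rcases le_total (r ^ 2 - ‖x - a‖ ^ 2) 0 with h | h
  · have : bump a r x = 0 := max_eq_right h
    have := bump_nonneg (a := a) (r := r) (x + z)
    have := bump_nonneg (a := a) (r := r) (x - z)
    nlinarith [sq_nonneg ‖z‖]
  · have ex : bump a r x = r ^ 2 - ‖x - a‖ ^ 2 := max_eq_left h
    have h1 : r ^ 2 - ‖x + z - a‖ ^ 2 ≤ bump a r (x + z) := le_max_left _ _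
    have h2 : r ^ 2 - ‖x - z - a‖ ^ 2 ≤ bump a r (x - z) := le_max_left _ _
    have h3 := parallelogram_law_with_norm ℝ (x - a) z
    rw [show x - a + z = x + z - a by abel, show x - a - z = x - z - a by abel] at h3
    nlinarith

lemma integrable_bump : Integrable (bump a r) := by
  refine continuous_bump.integrable_of_hasCompactSupport ?_
  refine HasCompactSupport.intro (isCompact_closedBall a |r|) fun x hx => ?_
  rw [Metric.mem_closedBall, dist_eq_norm, not_le] at hx
  refine max_eq_right ?_
  rw [← sq_abs r]
  nlinarith [abs_nonneg r]

lemma finEnergy_bump (hK : RealProfile N K) (hr : 0 ≤ r) : FinEnergy K (bump a r) := by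
  refine ⟨continuous_bump.measurable, ?_⟩
  -- A squared difference of values is at most `r ^ 4`, by the size of the bump, and at most `4 * r
  -- ^ 2 * ‖x - y‖ ^ 2`, by its Lipschitz constant.
  set C := r ^ 4 + 4 * r ^ 2
  have hi : Integrable ((Metric.ball a r).indicator fun _ : Space N => C) := by
    rw [integrable_indicator_iff Metric.isOpen_ball.measurableSet]
    exact integrableOn_const Metric.isBounded_ball.measure_lt_top.ne
  -- The majorant is the convolution integrand of `C` on the ball with the truncated kernel, plus
  -- its transpose, since either point may be the one in the ball.
  have h1 := hi.convolution_integrand (ContinuousLinearMap.mul ℝ ℝ) hK.integrable_min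
  have h2 := h1.add h1.swap
  refine h2.mono' ((((continuous_bump.measurable.comp measurable_fst).sub
    (continuous_bump.measurable.comp measurable_snd)).pow_const 2).mul
      hK.meas_sub).aestronglyMeasurable (Filter.Eventually.of_forall fun p => ?_)
  have hk := hK.nonneg ‖p.1 - p.2‖
  rw [Real.norm_of_nonneg (mul_nonneg (sq_nonneg _) hk)]
  simp only [ContinuousLinearMap.mul_apply', Pi.add_apply, Function.comp_apply, Prod.fst_swap,
    Prod.snd_swap]
  rw [norm_sub_rev p.2 p.1, ← add_mul, ← mul_assoc]
  refine mul_le_mul_of_nonneg_right ?_ hk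
  have hmin : 0 ≤ min 1 (‖p.1 - p.2‖ ^ 2) := le_min zero_le_one (sq_nonneg _)
  have hC : 0 ≤ C := by positivity
  have hn : ∀ x : Space N, 0 ≤ (Metric.ball a r).indicator (fun _ : Space N => C) x :=
    fun x => indicator_nonneg (fun _ _ => hC) x
  by_cases hz : p.1 ∈ Metric.ball a r ∨ p.2 ∈ Metric.ball a r
  · have hCle : C ≤ (Metric.ball a r).indicator (fun _ : Space N => C) p.2
        + (Metric.ball a r).indicator (fun _ : Space N => C) p.1 := by
      rcases hz with h | h
      · rw [indicator_of_mem h]; linarith [hn p.2]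
      · rw [indicator_of_mem h]; linarith [hn p.1]
    refine le_trans ?_ (mul_le_mul_of_nonneg_right hCle hmin)
    have b1 : (bump a r p.1 - bump a r p.2) ^ 2 ≤ (r ^ 2) ^ 2 := by
      rw [sq_le_sq, abs_of_nonneg (sq_nonneg r), abs_le]
      constructor <;> linarith [bump_nonneg (a := a) (r := r) p.1, bump_le (a := a) (r := r) p.1,
        bump_nonneg (a := a) (r := r) p.2, bump_le (a := a) (r := r) p.2]
    have b2 : (bump a r p.1 - bump a r p.2) ^ 2 ≤ (2 * r * ‖p.1 - p.2‖) ^ 2 := by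
      rw [sq_le_sq, abs_of_nonneg (by positivity : 0 ≤ 2 * r * ‖p.1 - p.2‖)]
      exact abs_bump_sub_le hr _ _
    rcases min_choice 1 (‖p.1 - p.2‖ ^ 2) with h | h <;> rw [h]
    · nlinarith [sq_nonneg r]
    · nlinarith [mul_nonneg (pow_nonneg hr 4) (sq_nonneg ‖p.1 - p.2‖)]
  · push Not at hz
    have e1 : bump a r p.1 = 0 := bump_of_le hr (by simpa [dist_eq_norm] using hz.1)
    have e2 : bump a r p.2 = 0 := bump_of_le hr (by simpa [dist_eq_norm] using hz.2)
    rw [e1, e2, sub_zero, zero_pow two_ne_zero]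
    exact mul_nonneg (add_nonneg (hn _) (hn _)) hmin

end bump

/-! ### The form through second differences -/

section secondDifference

variable {N : ℕ} {K : ℝ → ℝ} {g φ : Space N → ℝ}

/-- If the second differences of `g`, weighted by `φ`, are controlled by `min 1 |z|²`, then the
form is controlled by the `L¹` norm of `φ`. -/
lemma form_le_of_second_difference (hK : RealProfile N K) (hg : FinEnergy K g)
    (hφ : FinEnergy K φ) (hφi : Integrable φ) {M : ℝ} (hgb : ∀ x, |g x| ≤ M) {C : ℝ}
    (h : ∀ x z, φ x * (2 * g x - g (x + z) - g (x - z)) ≤ C * min 1 (‖z‖ ^ 2) * |φ x|) :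
    form K g φ ≤ C * (∫ z : Space N, min 1 (‖z‖ ^ 2) * K ‖z‖) * ∫ x, |φ x| := by
  have hF := hg.integrable_mul hK hφ
  have hmp : MeasurePreserving (fun p : Space N × Space N => (p.1, p.1 + p.2)) volume volume :=
    measurePreserving_prod_add volume volume
  have hme : MeasurableEmbedding (fun p : Space N × Space N => (p.1, p.1 + p.2)) :=
    (MeasurableEquiv.shearAddRight (Space N)).measurableEmbedding
  have hF' := (hmp.integrable_comp_emb hme).2 hF
  have e1 : form K g φ = ∫ p : Space N × Space N,
      (g p.1 - g (p.1 + p.2)) * (φ p.1 - φ (p.1 + p.2)) * K ‖p.2‖ := by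
    unfold form
    rw [← hmp.integral_comp hme]
    congr 1; ext p
    simp
  have hF'' : Integrable fun p : Space N × Space N =>
      (g p.1 - g (p.1 + p.2)) * (φ p.1 - φ (p.1 + p.2)) * K ‖p.2‖ := by
    refine hF'.congr (Filter.Eventually.of_forall fun p => ?_)
    simp
  have hbdd : ∀ (f : Space N → ℝ), Measurable f → (∀ x, |f x| ≤ M) → ∀ ψ : Space N → ℝ,
      Integrable ψ → Integrable fun x => f x * ψ x := fun f hf hfb ψ hψ =>
    hψ.bdd_mul (c := M) hf.aestronglyMeasurable (Filter.Eventually.of_forall hfb)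
  -- A translation by `z` moves the difference from `φ` onto `g`, turning a first difference of `g`
  -- into a second one.
  have inner : ∀ z : Space N, ∫ x, (g x - g (x + z)) * (φ x - φ (x + z))
      = ∫ x, φ x * (2 * g x - g (x + z) - g (x - z)) := by
    intro z
    have i1 : Integrable fun x => (g x - g (x + z)) * φ x := by
      refine ((hbdd g hg.meas hgb φ hφi).sub (hbdd (fun x => g (x + z))
        (hg.meas.comp (measurable_add_const z)) (fun x => hgb _) φ hφi)).congr
        (Filter.Eventually.of_forall fun x => ?_)
      simp only [Pi.sub_apply]; ring
    have i2 : Integrable fun x => (g (x - z) - g x) * φ x := by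
      refine ((hbdd (fun x => g (x - z))
        (hg.meas.comp (measurable_sub_const z)) (fun x => hgb _) φ hφi).sub
          (hbdd g hg.meas hgb φ hφi)).congr (Filter.Eventually.of_forall fun x => ?_)
      simp only [Pi.sub_apply]; ring
    have i2' : Integrable fun x => (g x - g (x + z)) * φ (x + z) := by
      simpa using i2.comp_add_right z
    have e2 : ∫ x, (g x - g (x + z)) * φ (x + z) = ∫ x, (g (x - z) - g x) * φ x := by
      rw [← integral_add_right_eq_self (fun x => (g (x - z) - g x) * φ x) z]
      simp
    calc ∫ x, (g x - g (x + z)) * (φ x - φ (x + z))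
        = ∫ x, ((g x - g (x + z)) * φ x - (g x - g (x + z)) * φ (x + z)) := by
          congr 1; ext x; ring
      _ = ∫ x, ((g x - g (x + z)) * φ x - (g (x - z) - g x) * φ x) := by
          rw [integral_sub i1 i2', e2, ← integral_sub i1 i2]
      _ = _ := by congr 1; ext x; ring
  rw [e1, Measure.volume_eq_prod, integral_prod_symm _ hF'', mul_assoc, mul_comm (∫ z, _) _,
    ← mul_assoc, ← integral_const_mul]
  refine integral_mono_ae hF''.integral_prod_right (hK.integrable_min.const_mul _)
    (Filter.Eventually.of_forall fun z => ?_)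
  simp only
  rw [integral_mul_const, inner z, ← mul_assoc]
  refine mul_le_mul_of_nonneg_right ?_ (hK.nonneg _)
  have hi : Integrable fun x => φ x * (2 * g x - g (x + z) - g (x - z)) := by
    refine ((hbdd g hg.meas hgb φ hφi).const_mul 2 |>.sub (hbdd (fun x => g (x + z))
      (hg.meas.comp (measurable_add_const z)) (fun x => hgb _) φ hφi) |>.sub
      (hbdd (fun x => g (x - z))
        (hg.meas.comp (measurable_sub_const z)) (fun x => hgb _) φ hφi)).congr
        (Filter.Eventually.of_forall fun x => ?_)
    simp only [Pi.sub_apply]; ring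
  calc _ ≤ ∫ x, C * min 1 (‖z‖ ^ 2) * |φ x| := integral_mono hi (hφi.abs.const_mul _) (h · z)
    _ = _ := by rw [integral_const_mul]; ring

end secondDifference

/-! ### Estimates for the odd barrier -/

section odd

variable {N : ℕ} {K : ℝ → ℝ} {e : Space N} {g h φ : Space N → ℝ}

/-- Invariance of the form moves the reflection from `g` to `φ`, where oddness turns it into a sign.
-/
lemma form_sub_mirror (hK : RealProfile N K) (hg : FinEnergy K g) (hφ : FinEnergy K φ)
    (hφa : ∀ x, φ (mirror e x) = -φ x) :
    form K (fun x => g x - g (mirror e x)) φ = 2 * form K g φ := by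
  rw [form_sub_left hK hg (hg.comp_isometry (mirror e)) hφ]
  have h1 := form_comp_isometry (K := K) (fun x => g (mirror e x)) φ (mirror e)
  simp only [mirror_mirror, hφa] at h1
  have h2 : form K g (fun x => -φ x) = -form K g φ := by
    unfold form
    rw [← integral_neg]
    congr 1; ext p; ring
  linarith

lemma sub_mirror_odd (g : Space N → ℝ) (x : Space N) :
    g (mirror e x) - g (mirror e (mirror e x)) = -(g x - g (mirror e x)) := by
  rw [mirror_mirror]; ring

/-- The form of two odd functions with disjoint supports. -/
lemma form_le_neg_of_separated (hK : RealProfile N K) (hh : FinEnergy K h) (hφ : FinEnergy K φ)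
    (hha : ∀ x, h (mirror e x) = -h x) (hφa : ∀ x, φ (mirror e x) = -φ x)
    (hhi : Integrable h) (hφi : Integrable φ) (hdisj : ∀ x, h x * φ x = 0)
    (hsep : ∀ x y, |h x| * |φ y| ≤ h x * φ y * (K ‖x - y‖ - K ‖x - mirror e y‖)) :
    form K h φ ≤ -((∫ x, |h x|) * ∫ x, |φ x|) := by
  rw [form_eq_pairing hK hh hφ hha hφa]
  have hsym : ∀ x y, ‖x - mirror e y‖ = ‖y - mirror e x‖ := fun x y => by
    rw [← (mirror e).norm_map, map_sub, mirror_mirror, norm_sub_rev]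
  have i1 : Integrable fun p : Space N × Space N => |h p.1| * |φ p.2| := hhi.abs.mul_prod hφi.abs
  have i2 : Integrable fun p : Space N × Space N => |φ p.1| * |h p.2| := hφi.abs.mul_prod hhi.abs
  -- Disjointness kills the products at a single point; each of the two mixed products is controlled
  -- by `hsep`, and together they compensate the factor `1 / 2`.
  have hle : ∫ p : Space N × Space N,
      ((h p.1 - h p.2) * (φ p.1 - φ p.2) * K ‖p.1 - p.2‖
        + (h p.1 + h p.2) * (φ p.1 + φ p.2) * K ‖p.1 - mirror e p.2‖)
      ≤ ∫ p : Space N × Space N, -(|h p.1| * |φ p.2| + |φ p.1| * |h p.2|) := by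
    refine integral_mono ((hh.integrable_mul hK hφ).add (integrable_flip hK hh hφ hha hφa))
      (i1.add i2).neg fun p => ?_
    have s1 := hsep p.1 p.2
    have s2 := hsep p.2 p.1
    rw [norm_sub_rev p.2 p.1, hsym p.2 p.1] at s2
    have d1 := hdisj p.1
    have d2 := hdisj p.2
    simp only
    generalize K ‖p.1 - p.2‖ = J at *
    generalize K ‖p.1 - mirror e p.2‖ = J' at *
    have key : (h p.1 - h p.2) * (φ p.1 - φ p.2) * J + (h p.1 + h p.2) * (φ p.1 + φ p.2) * J'
      = h p.1 * φ p.1 * (J + J') + h p.2 * φ p.2 * (J + J') - h p.1 * φ p.2 * (J - J')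
        - h p.2 * φ p.1 * (J - J') := by ring
    rw [key, d1, d2]
    linarith
  rw [integral_neg, integral_add i1 i2, Measure.volume_eq_prod, integral_prod_mul (fun x => |h x|)
    (fun x => |φ x|), integral_prod_mul (fun x => |φ x|) (fun x => |h x|)] at hle
  rw [Measure.volume_eq_prod]
  linarith

lemma bump_mirror_eq_zero {a : Space N} (he : e ≠ 0) {r : ℝ} (hr : 0 ≤ r)
    (hball : ∀ x, ‖x - a‖ < r → 0 < inner ℝ x e) {x : Space N} (hx : 0 < inner ℝ x e) :
    bump a r (mirror e x) = 0 := by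
  by_contra hb
  have h1 := hball _ (bump_ne_zero hr hb)
  rw [inner_mirror he] at h1
  linarith

/-- It suffices to test a single bump. On the ball `φ ≥ 0`, and the one-sided second difference
bound applies. On the reflected ball `φ ≤ 0`, so the opposite bound is needed; there the bump
vanishes at all points within distance `d`. -/
lemma form_sub_mirror_bump_le (hK : RealProfile N K) {a : Space N} {r : ℝ} (hr : 0 < r)
    (hdist : 4 * r ≤ ‖a - mirror e a‖) : ∃ C : ℝ, 0 ≤ C ∧ ∀ φ : Space N → ℝ, FinEnergy K φ →
      (∀ x, φ (mirror e x) = -φ x) → Integrable φ → (∀ x, ‖x - a‖ < r → 0 ≤ φ x) →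
      (∀ x, φ x ≠ 0 → ‖x - a‖ < r ∨ ‖mirror e x - a‖ < r) →
      form K (fun x => bump a r x - bump a r (mirror e x)) φ ≤ C * ∫ x, |φ x| := by
  set d := ‖a - mirror e a‖ - 2 * r with hd
  have hd0 : 0 < d := by linarith
  -- The summands serve, in turn, the quadratic bound on the ball, the size bound when the minimum
  -- is `1`, and displacements of length at least `d` from reflected points.
  set C := 2 + 2 * r ^ 2 + 2 * r ^ 2 / d ^ 2 with hC
  have hq : 0 ≤ 2 * r ^ 2 / d ^ 2 := by positivity
  have hI : 0 ≤ ∫ z : Space N, min 1 (‖z‖ ^ 2) * K ‖z‖ :=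
    integral_nonneg fun z => mul_nonneg (le_min zero_le_one (sq_nonneg _)) (hK.nonneg _)
  refine ⟨2 * (C * ∫ z : Space N, min 1 (‖z‖ ^ 2) * K ‖z‖),
    mul_nonneg zero_le_two (mul_nonneg (by linarith [sq_nonneg r]) hI), ?_⟩
  intro φ hφ hφa hφi hpos hsupp
  have hg := finEnergy_bump hK (a := a) hr.le
  rw [form_sub_mirror hK hg hφ hφa, mul_assoc 2]
  refine mul_le_mul_of_nonneg_left ?_ zero_le_two
  refine form_le_of_second_difference hK hg hφ hφi (M := r ^ 2)
    (fun x => by rw [abs_of_nonneg (bump_nonneg x)]; exact bump_le x) fun x z => ?_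
  by_cases h0 : φ x = 0
  · simp [h0]
  have b1 := bump_nonneg (a := a) (r := r) (x + z)
  have b2 := bump_nonneg (a := a) (r := r) (x - z)
  have b3 := bump_le (a := a) (r := r) x
  have hz := sq_nonneg ‖z‖
  by_cases hx : ‖x - a‖ < r
  · rw [abs_of_nonneg (hpos x hx), mul_comm]
    refine mul_le_mul_of_nonneg_right ?_ (hpos x hx)
    have b4 := bump_second_difference_le (a := a) (r := r) x z
    rcases min_choice 1 (‖z‖ ^ 2) with h | h <;> rw [h]
    · linarith
    · nlinarith [mul_nonneg (sq_nonneg r) hz, mul_nonneg hq hz]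
  · have hm : ‖mirror e x - a‖ < r := (hsupp x h0).resolve_left hx
    have hneg : φ x ≤ 0 := by
      have := hpos _ hm
      rw [hφa] at this
      linarith
    have bx : bump a r x = 0 := bump_of_le hr.le (not_lt.1 hx)
    have hfar : ∀ y : Space N, ‖y‖ < d → bump a r (x + y) = 0 := by
      intro y hy
      refine bump_of_le hr.le ?_
      by_contra! hlt
      have e1 : ‖mirror e a - x‖ < r := by
        rw [← (mirror e).norm_map, map_sub, mirror_mirror, norm_sub_rev]; exact hm
      have : ‖a - mirror e a‖ ≤ ‖x + y - a‖ + ‖y‖ + ‖mirror e a - x‖ := by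
        calc ‖a - mirror e a‖ = ‖-(x + y - a) + y - (mirror e a - x)‖ := by congr 1; abel
          _ ≤ ‖-(x + y - a)‖ + ‖y‖ + ‖mirror e a - x‖ :=
            (norm_sub_le _ _).trans (by gcongr; exact norm_add_le _ _)
          _ = _ := by rw [norm_neg]
      linarith
    rw [abs_of_nonpos hneg, bx, mul_neg, ← neg_mul, mul_comm (-_)]
    have hgoal : bump a r (x + z) + bump a r (x - z) ≤ C * min 1 (‖z‖ ^ 2) := by
      by_cases hzd : ‖z‖ < d
      · rw [hfar z hzd, sub_eq_add_neg, hfar (-z) (by rwa [norm_neg]), add_zero]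
        exact mul_nonneg (by positivity) (le_min zero_le_one hz)
      · push Not at hzd
        have b4 := bump_le (a := a) (r := r) (x + z)
        have b5 := bump_le (a := a) (r := r) (x - z)
        rcases min_choice 1 (‖z‖ ^ 2) with h | h <;> rw [h]
        · linarith
        · have : 2 * r ^ 2 ≤ 2 * r ^ 2 / d ^ 2 * ‖z‖ ^ 2 := by
            rw [div_mul_eq_mul_div, le_div_iff₀ (by positivity)]
            gcongr
          nlinarith [mul_nonneg (sq_nonneg r) hz]
    nlinarith

end odd

/-! ### Local strong maximum principle -/

section strongMaximumPrinciple

variable {N : ℕ} [NeZero N] {K : ℝ → ℝ} {e : Space N} {w : Space N → ℝ}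

set_option maxHeartbeats 1600000 in
/-- Local strong maximum principle for odd supersolutions: zeros inside the half space are
interior zeros. -/
lemma eventually_eq_zero_of_supersolution (hK : RealProfile N K) (he : e ≠ 0)
    (hwc : Continuous w) (hw : FinEnergy K w) (hwa : ∀ x, w (mirror e x) = -w x)
    (hpos : ∀ x, 0 < inner ℝ x e → 0 ≤ w x) {x₀ : Space N} (hx₀ : 0 < inner ℝ x₀ e)
    {R : ℝ} (hR : 0 < R) {L : ℝ} (hL : 0 ≤ L)
    (hsuper : ∀ φ : Space N → ℝ, FinEnergy K φ → (∀ x, φ (mirror e x) = -φ x) →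
      SignedAlong e φ → (∃ C, ∀ x, |φ x| ≤ C) →
      (∀ x, φ x ≠ 0 → ‖x - x₀‖ < R ∨ ‖mirror e x - x₀‖ < R) →
      -(L * ∫ x, |w x| * |φ x|) ≤ form K w φ)
    (h0 : w x₀ = 0) : ∀ᶠ y in nhds x₀, w y = 0 := by
  have hc : Continuous fun x : Space N => inner ℝ x e := by fun_prop
  obtain ⟨R₁, hR₁, hball⟩ := Metric.isOpen_iff.1 (isOpen_lt continuous_const hc) x₀ hx₀
  set d := ‖x₀ - mirror e x₀‖ with hd
  have hd0 : 0 < d := by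
    refine norm_pos_iff.2 (sub_ne_zero.2 fun h => ?_)
    have := inner_mirror he x₀
    rw [← h] at this
    linarith
  -- Since `K` is unbounded at the origin, points closer than `s` interact more strongly, by at
  -- least `1`, than points at distance `d / 2` or more, such as a point and a reflected one here.
  obtain ⟨s, hs0, hs1, hsK⟩ := hK.exists_large (K (d / 2) + 1)
    (lt_min hR (lt_min hR₁ (by positivity : 0 < d / 4)))
  have hsR : s < R := hs1.trans_le (min_le_left _ _)
  have hsR₁ : s < R₁ := hs1.trans_le ((min_le_right _ _).trans (min_le_left _ _))
  have hsd : s < d / 4 := hs1.trans_le ((min_le_right _ _).trans (min_le_right _ _))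
  have hH : ∀ x, ‖x - x₀‖ < s → 0 < inner ℝ x e := fun x hx =>
    hball (by rw [Metric.mem_ball, dist_eq_norm]; linarith)
  refine Metric.eventually_nhds_iff.2 ⟨s / 2, by positivity, fun {y₀} hy₀ => ?_⟩
  rw [dist_eq_norm] at hy₀
  by_contra hne
  have hy₀H := hH y₀ (by linarith)
  have hwy₀ : 0 < w y₀ := lt_of_le_of_ne (hpos y₀ hy₀H) (Ne.symm hne)
  set r := ‖y₀ - x₀‖ / 4 with hr
  have hr0 : 0 < r := by
    have : y₀ ≠ x₀ := fun h => by rw [h, h0] at hne; exact hne rfl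
    have := norm_pos_iff.2 (sub_ne_zero.2 this)
    positivity
  have hr4 : ‖y₀ - x₀‖ = 4 * r := by rw [hr]; ring
  obtain ⟨ρ₁, hρ₁, hρw⟩ := Metric.eventually_nhds_iff.1
    (hwc.continuousAt.eventually_const_lt (half_lt_self hwy₀))
  set ρ := min r ρ₁ with hρ
  have hρ0 : 0 < ρ := lt_min hr0 hρ₁
  have hρr : ρ ≤ r := min_le_left _ _
  have hwδ : ∀ x, ‖x - y₀‖ < ρ → w y₀ / 2 < w x := fun x hx =>
    hρw (by rw [dist_eq_norm]; exact hx.trans_le (min_le_right _ _))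
  -- The barrier is `t * (g + τ * h)`. The bump `g` makes it positive at the zero `x₀` of `w`; the
  -- bump `h`, placed where `w` is bounded below, supplies the nonlocal gain near `x₀`.
  set g : Space N → ℝ := fun x => bump x₀ r x - bump x₀ r (mirror e x) with hg
  set h : Space N → ℝ := fun x => bump y₀ ρ x - bump y₀ ρ (mirror e x) with hh
  have hgE : FinEnergy K g := (finEnergy_bump hK hr0.le).sub hK
    ((finEnergy_bump hK hr0.le).comp_isometry (mirror e))
  have hhE : FinEnergy K h := (finEnergy_bump hK hρ0.le).sub hK
    ((finEnergy_bump hK hρ0.le).comp_isometry (mirror e))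
  have hga : ∀ x, g (mirror e x) = -g x := sub_mirror_odd _
  have hha : ∀ x, h (mirror e x) = -h x := sub_mirror_odd _
  have bx : ∀ x, ‖x - x₀‖ < r → ‖x - x₀‖ < s := fun x hx => by linarith
  have bxy : ∀ x, ‖x - y₀‖ < ρ → ‖x - x₀‖ < s := fun x hx => by
    have := norm_sub_le_norm_sub_add_norm_sub x y₀ x₀
    linarith
  -- in the half space the reflected bumps vanish
  have hgH : ∀ x, 0 < inner ℝ x e → g x = bump x₀ r x := fun x hx => by
    simp only [hg, bump_mirror_eq_zero he hr0.le (fun x hx => hH x (bx x hx)) hx, sub_zero]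
  have hhH : ∀ x, 0 < inner ℝ x e → h x = bump y₀ ρ x := fun x hx => by
    simp only [hh, bump_mirror_eq_zero he hρ0.le (fun x hx => hH x (bxy x hx)) hx, sub_zero]
  have hhi : Integrable h := integrable_bump.sub
    ((mirror e).measurePreserving.integrable_comp_emb
      (mirror e).toHomeomorph.measurableEmbedding |>.2 integrable_bump)
  have hhc : Continuous h := continuous_bump.sub (continuous_bump.comp (mirror e).continuous)
  have hgc : Continuous g := continuous_bump.sub (continuous_bump.comp (mirror e).continuous)
  set Ih := ∫ x, |h x| with hIh
  have hIpos : 0 < Ih := by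
    refine (integral_pos_iff_support_of_nonneg (fun x => abs_nonneg _) hhi.abs).2 ?_
    refine hhc.abs.isOpen_support.measure_pos _ ⟨y₀, ?_⟩
    have : h y₀ ≠ 0 := by
      rw [hhH y₀ hy₀H]
      exact (bump_pos (by simpa using hρ0)).ne'
    simpa using this
  obtain ⟨C, hC0, hC⟩ := form_sub_mirror_bump_le (e := e) hK hr0 (a := x₀) (by linarith)
  -- The gain `τ * Ih` beats the constant `C` of `g` and the zeroth order term `L * r ^ 2`, with `1`
  -- to spare.
  set τ := (L * r ^ 2 + C + 1) / Ih with hτ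
  have hτ0 : 0 < τ := by positivity
  have hτI : τ * Ih = L * r ^ 2 + C + 1 := div_mul_cancel₀ _ hIpos.ne'
  -- This keeps `t * τ * h ≤ w y₀ / 2 < w` on the ball around `y₀`.
  set t := w y₀ / 2 / (τ * ρ ^ 2) with ht
  have ht0 : 0 < t := by positivity
  have htρ : t * (τ * ρ ^ 2) = w y₀ / 2 := div_mul_cancel₀ _ (by positivity)
  set z : Space N → ℝ := fun x => w x - t * (g x + τ * h x) with hz
  have hψE : FinEnergy K fun x => g x + τ * h x := hgE.add hK (hhE.const_mul τ)
  have hzE : FinEnergy K z := hw.sub hK (hψE.const_mul t)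
  have hza : ∀ x, z (mirror e x) = -z x := fun x => by simp only [hz, hwa, hga, hha]; ring
  have hzc : Continuous z := hwc.sub (continuous_const.mul (hgc.add (continuous_const.mul hhc)))
  set φ := oddNegPart e z with hφ
  have hφE : FinEnergy K φ := finEnergy_oddNegPart hK he hzE hza
  have hφa : ∀ x, φ (mirror e x) = -φ x := oddNegPart_mirror he hza
  have hφs : SignedAlong e φ := signedAlong_oddNegPart
  -- `φ` lives where `w < t g`
  have hφH : ∀ x, 0 < inner ℝ x e → φ x ≠ 0 → ‖x - x₀‖ < r ∧ w x < t * r ^ 2 ∧ φ x ≤ t * r ^ 2 := by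
    intro x hx hne
    have e1 : φ x = max (-z x) 0 := oddNegPart_of_pos hx
    have hzneg : z x < 0 := by
      by_contra! hge
      exact hne (by rw [e1]; exact max_eq_right (by linarith))
    have e2 : φ x = -z x := by rw [e1]; exact max_eq_left (by linarith)
    have e3 : z x = w x - t * (bump x₀ r x + τ * bump y₀ ρ x) := by
      simp only [hz, hgH x hx, hhH x hx]
    have hwx := hpos x hx
    have hxr : ‖x - x₀‖ < r := by
      by_contra! hge
      rw [bump_of_le hr0.le hge, zero_add] at e3
      by_cases hy : ‖x - y₀‖ < ρ
      · have h1 := hwδ x hy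
        have h2 : t * (τ * bump y₀ ρ x) ≤ t * (τ * ρ ^ 2) := by
          gcongr; exact bump_le x
        linarith
      · rw [bump_of_le hρ0.le (not_lt.1 hy)] at e3
        simp only [mul_zero, sub_zero] at e3
        linarith
    have hyρ : bump y₀ ρ x = 0 := by
      refine bump_of_le hρ0.le ?_
      have := norm_sub_le_norm_sub_add_norm_sub y₀ x x₀
      rw [norm_sub_rev y₀ x] at this
      linarith
    rw [hyρ, mul_zero, add_zero] at e3
    have h2 : t * bump x₀ r x ≤ t * r ^ 2 := by gcongr; exact bump_le x
    exact ⟨hxr, by linarith, by linarith⟩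
  have hφany : ∀ x, φ x ≠ 0 → (0 < inner ℝ x e ∧ ‖x - x₀‖ < r) ∨
      (0 < inner ℝ (mirror e x) e ∧ ‖mirror e x - x₀‖ < r) := by
    intro x hne
    rcases lt_trichotomy (inner ℝ x e) 0 with hx | hx | hx
    · have hx' : 0 < inner ℝ (mirror e x) e := by rw [inner_mirror he]; linarith
      exact Or.inr ⟨hx', (hφH _ hx' (by rw [hφa]; simpa using hne)).1⟩
    · exact absurd (oddNegPart_of_eq hx) hne
    · exact Or.inl ⟨hx, (hφH _ hx hne).1⟩
  have hbound : ∀ x, φ x ≠ 0 → |w x| ≤ t * r ^ 2 ∧ |φ x| ≤ t * r ^ 2 := by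
    have key : ∀ x, 0 < inner ℝ x e → φ x ≠ 0 → |w x| ≤ t * r ^ 2 ∧ |φ x| ≤ t * r ^ 2 := by
      intro x hx hne
      have h1 := hφH x hx hne
      rw [abs_of_nonneg (hpos x hx), abs_of_nonneg ((hφs x).1 hx.le)]
      exact ⟨h1.2.1.le, h1.2.2⟩
    intro x hne
    rcases hφany x hne with hx | hx
    · exact key x hx.1 hne
    · have := key _ hx.1 (by rw [hφa]; simpa using hne)
      simpa [hwa, hφa] using this
  have hφb : ∀ x, |φ x| ≤ t * r ^ 2 := fun x => by
    by_cases hne : φ x = 0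
    · rw [hne, abs_zero]; positivity
    · exact (hbound x hne).2
  have hφi : Integrable φ := by
    set A := Metric.ball x₀ r ∪ mirror e ⁻¹' Metric.ball x₀ r with hA
    have hAm : MeasurableSet A := Metric.isOpen_ball.measurableSet.union
      ((Metric.isOpen_ball.preimage (mirror e).continuous).measurableSet)
    have hAv : volume A ≠ ∞ := by
      refine (measure_union_lt_top Metric.isBounded_ball.measure_lt_top ?_).ne
      rw [(mirror e).measurePreserving.measure_preimage
        Metric.isOpen_ball.measurableSet.nullMeasurableSet]
      exact Metric.isBounded_ball.measure_lt_top
    have : Integrable (A.indicator fun _ => t * r ^ 2) := by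
      rw [integrable_indicator_iff hAm]
      exact integrableOn_const hAv
    refine this.mono' hφE.meas.aestronglyMeasurable (Filter.Eventually.of_forall fun x => ?_)
    by_cases hne : φ x = 0
    · rw [hne, norm_zero]
      exact indicator_nonneg (fun _ _ => by positivity) x
    · rw [indicator_of_mem]
      · exact hφb x
      · rcases hφany x hne with hx | hx
        · exact Or.inl (by simpa [dist_eq_norm] using hx.2)
        · exact Or.inr (by rw [mem_preimage, Metric.mem_ball, dist_eq_norm]; exact hx.2)
  have hwφ : ∫ x, |w x| * |φ x| ≤ t * r ^ 2 * ∫ x, |φ x| := by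
    rw [← integral_const_mul]
    refine integral_mono_of_nonneg (Filter.Eventually.of_forall fun x => by positivity)
      (hφi.abs.const_mul _) (Filter.Eventually.of_forall fun x => ?_)
    simp only
    by_cases hne : φ x = 0
    · simp [hne]
    · exact mul_le_mul_of_nonneg_right (hbound x hne).1 (abs_nonneg _)
  have hF1 := hsuper φ hφE hφa hφs ⟨_, hφb⟩ fun x hne => by
    rcases hφany x hne with hx | hx
    · exact Or.inl (by linarith [hx.2])
    · exact Or.inr (by linarith [hx.2])
  have hF2 := hC φ hφE hφa hφi (fun x hx => (hφs x).1 (hH x (bx x hx)).le) fun x hne => by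
    rcases hφany x hne with hx | hx
    · exact Or.inl hx.2
    · exact Or.inr hx.2
  -- separation of the supports of `h` and `φ`
  have hker : ∀ x y, ‖x - y₀‖ < ρ → ‖y - x₀‖ < r → 1 ≤ K ‖x - y‖ - K ‖x - mirror e y‖ := by
    intro x y hx hy
    have n1 : ‖y₀ - x₀‖ ≤ ‖x - y₀‖ + ‖x - y‖ + ‖y - x₀‖ := by
      calc ‖y₀ - x₀‖ = ‖-(x - y₀) + (x - y) + (y - x₀)‖ := by congr 1; abel
        _ ≤ ‖-(x - y₀)‖ + ‖x - y‖ + ‖y - x₀‖ := norm_add₃_le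
        _ = _ := by rw [norm_neg]
    have n2 : ‖x - y‖ ≤ ‖x - y₀‖ + ‖y₀ - x₀‖ + ‖y - x₀‖ := by
      calc ‖x - y‖ = ‖(x - y₀) + (y₀ - x₀) + -(y - x₀)‖ := by congr 1; abel
        _ ≤ ‖x - y₀‖ + ‖y₀ - x₀‖ + ‖-(y - x₀)‖ := norm_add₃_le
        _ = _ := by rw [norm_neg]
    have n3 : d ≤ ‖x - x₀‖ + ‖x - mirror e y‖ + ‖y - x₀‖ := by
      calc d = ‖-(x - x₀) + (x - mirror e y) + (mirror e y - mirror e x₀)‖ := by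
            rw [hd]; congr 1; abel
        _ ≤ ‖-(x - x₀)‖ + ‖x - mirror e y‖ + ‖mirror e y - mirror e x₀‖ := norm_add₃_le
        _ = _ := by rw [norm_neg, ← map_sub, LinearIsometryEquiv.norm_map]
    have n4 := bxy x hx
    -- Since `4 * r < s / 2`, one has `‖x - y‖ ≤ 6 * r < s`; and the reflected distance is at least
    -- `d - s - r > d / 2`.
    have k1 : K s ≤ K ‖x - y‖ := hK.anti (mem_Ioi.2 (by linarith)) (mem_Ioi.2 hs0) (by linarith)
    have k2 : K ‖x - mirror e y‖ ≤ K (d / 2) :=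
      hK.anti (mem_Ioi.2 (by linarith)) (mem_Ioi.2 (by linarith)) (by linarith)
    linarith
  have hhany : ∀ x, h x ≠ 0 → (0 < inner ℝ x e ∧ ‖x - y₀‖ < ρ) ∨
      (0 < inner ℝ (mirror e x) e ∧ ‖mirror e x - y₀‖ < ρ) := by
    have key : ∀ x, 0 < inner ℝ x e → h x ≠ 0 → ‖x - y₀‖ < ρ := fun x hx hne =>
      bump_ne_zero hρ0.le (by rwa [hhH x hx] at hne)
    intro x hne
    rcases lt_trichotomy (inner ℝ x e) 0 with hx | hx | hx
    · have hx' : 0 < inner ℝ (mirror e x) e := by rw [inner_mirror he]; linarith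
      exact Or.inr ⟨hx', key _ hx' (by rw [hha]; simpa using hne)⟩
    · exact absurd (odd_eq_zero hha hx) hne
    · exact Or.inl ⟨hx, key _ hx hne⟩
  have hhpos : ∀ x, 0 < inner ℝ x e → 0 ≤ h x := fun x hx => by
    rw [hhH x hx]; exact bump_nonneg x
  have hsep0 : ∀ x y, 0 < inner ℝ x e → 0 < inner ℝ y e → ‖x - y₀‖ < ρ → ‖y - x₀‖ < r →
      |h x| * |φ y| ≤ h x * φ y * (K ‖x - y‖ - K ‖x - mirror e y‖) := by
    intro x y hx hy hx' hy'
    have h1 := hhpos x hx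
    have h2 := (hφs y).1 hy.le
    rw [abs_of_nonneg h1, abs_of_nonneg h2]
    exact le_mul_of_one_le_right (mul_nonneg h1 h2) (hker x y hx' hy')
  have hnm : ∀ x y, ‖mirror e x - y‖ = ‖x - mirror e y‖ := fun x y => by
    rw [← (mirror e).norm_map, map_sub, mirror_mirror]
  have hsep : ∀ x y, |h x| * |φ y| ≤ h x * φ y * (K ‖x - y‖ - K ‖x - mirror e y‖) := by
    intro x y
    by_cases hx : h x = 0
    · simp [hx]
    by_cases hy : φ y = 0
    · simp [hy]
    rcases hhany x hx with hx | hx <;> rcases hφany y hy with hy | hy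
    · exact hsep0 x y hx.1 hy.1 hx.2 hy.2
    · have := hsep0 x _ hx.1 hy.1 hx.2 hy.2
      rw [hφa, abs_neg, mirror_mirror] at this
      linarith
    · have := hsep0 _ y hx.1 hy.1 hx.2 hy.2
      rw [hha, abs_neg, hnm, hnm, mirror_mirror] at this
      linarith
    · have := hsep0 _ _ hx.1 hy.1 hx.2 hy.2
      rw [hha, hφa, abs_neg, abs_neg, hnm, hnm, mirror_mirror] at this
      linarith
  have hdisj : ∀ x, h x * φ x = 0 := by
    have key : ∀ x, 0 < inner ℝ x e → h x * φ x = 0 := by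
      intro x hx
      by_cases hne : φ x = 0
      · rw [hne, mul_zero]
      · have h1 := (hφH x hx hne).1
        rw [hhH x hx, bump_of_le hρ0.le, zero_mul]
        have := norm_sub_le_norm_sub_add_norm_sub y₀ x x₀
        rw [norm_sub_rev y₀ x] at this
        linarith
    intro x
    by_cases hne : φ x = 0
    · rw [hne, mul_zero]
    rcases hφany x hne with hx | hx
    · exact key x hx.1
    · have := key _ hx.1
      rw [hha, hφa] at this
      linarith
  have hF3 := form_le_neg_of_separated hK hhE hφE hha hφa hhi hφi hdisj hsep
  have hF4 := form_oddNegPart_le hK he hzE hza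
  have hF5 := form_self_nonneg (u := φ) hK
  have hF6 : form K z φ = form K w φ - t * (form K g φ + τ * form K h φ) := by
    rw [form_sub_left hK hw (hψE.const_mul t) hφE, form_const_mul_left,
      form_add_left hK hgE (hhE.const_mul τ) hφE, form_const_mul_left]
  set I := ∫ x, |φ x| with hI
  -- At `x₀` the function `z` equals minus `t` times the top of the bump, so `φ` is positive nearby.
  have hI0 : 0 < I := by
    refine (integral_pos_iff_support_of_nonneg (fun x => abs_nonneg _) hφi.abs).2 ?_
    have hopen : IsOpen {x : Space N | 0 < inner ℝ x e ∧ z x < 0} :=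
      (isOpen_lt continuous_const hc).inter (isOpen_lt hzc continuous_const)
    refine (hopen.measure_pos volume ⟨x₀, hx₀, ?_⟩).trans_le (measure_mono fun x hx => ?_)
    · have : z x₀ = -(t * bump x₀ r x₀) := by
        simp only [hz, hgH x₀ hx₀, hhH x₀ hx₀, h0]
        rw [bump_of_le hρ0.le (a := y₀) (by rw [norm_sub_rev]; linarith)]
        ring
      rw [this]
      have := bump_pos (a := x₀) (r := r) (x := x₀) (by simpa using hr0)
      exact neg_lt_zero.2 (by positivity)
    · have e1 : φ x = max (-z x) 0 := oddNegPart_of_pos hx.1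
      have e2 : φ x ≠ 0 := by
        rw [e1]
        exact (lt_max_of_lt_left (neg_pos.2 hx.2)).ne'
      simpa using e2
  -- In total `0 ≤ form φ φ ≤ -form z φ ≤ t * I * (L * r ^ 2 + C - τ * Ih) = -(t * I)`, a
  -- contradiction.
  have e1 : L * ∫ x, |w x| * |φ x| ≤ L * (t * r ^ 2 * I) := by gcongr
  have e2 : t * (form K g φ + τ * form K h φ) ≤ t * (C * I + τ * -(Ih * I)) := by gcongr
  have e3 : t * (C * I + τ * -(Ih * I)) = t * (C * I - (τ * Ih) * I) := by ring
  rw [e3, hτI] at e2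
  have : 0 ≤ -(t * I) := by nlinarith
  have := mul_pos ht0 hI0
  linarith

end strongMaximumPrinciple

/-! ### Consequences of cooperativity -/

section nonlinearity

variable {m : ℕ} {f : ℝ × (Fin m → ℝ) → ℝ}

lemma exists_lipschitz_of_contDiffOn
    (hf : ContDiffOn ℝ 1 f (Ici (0 : ℝ) ×ˢ (univ : Set (Fin m → ℝ)))) (R M : ℝ) :
    ∃ L : ℝ, 0 ≤ L ∧ ∀ r, 0 ≤ r → r ≤ R → ∀ a b : Fin m → ℝ, ‖a‖ ≤ M → ‖b‖ ≤ M →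
      |f (r, a) - f (r, b)| ≤ L * ‖a - b‖ := by
  set S := Ici (0 : ℝ) ×ˢ (univ : Set (Fin m → ℝ))
  set T := Icc (0 : ℝ) R ×ˢ Metric.closedBall (0 : Fin m → ℝ) M
  have hTS : T ⊆ S := prod_mono (fun x hx => hx.1) (subset_univ _)
  have hS : UniqueDiffOn ℝ S := (uniqueDiffOn_Ici 0).prod uniqueDiffOn_univ
  have hT : IsCompact T := isCompact_Icc.prod (isCompact_closedBall _ _)
  have hTc : Convex ℝ T := (convex_Icc _ _).prod (convex_closedBall _ _)
  have hcont : ContinuousOn (fderivWithin ℝ f S) T :=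
    (hf.continuousOn_fderivWithin hS le_rfl).mono hTS
  obtain ⟨C, hC⟩ := hT.exists_bound_of_continuousOn hcont
  refine ⟨max C 0, le_max_right _ _, fun r h0 hR a b ha hb => ?_⟩
  have hd : ∀ x ∈ T, HasFDerivWithinAt f (fderivWithin ℝ f S x) T x := fun x hx =>
    (((hf.differentiableOn one_ne_zero) x (hTS hx)).hasFDerivWithinAt).mono hTS
  have := hTc.norm_image_sub_le_of_norm_hasFDerivWithin_le (x := (r, b)) (y := (r, a)) hd
    (fun x hx => (hC x hx).trans (le_max_left C 0)) ⟨⟨h0, hR⟩, by simpa using hb⟩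
    ⟨⟨h0, hR⟩, by simpa using ha⟩
  simpa [Prod.norm_def] using this

lemma differentiableAt_of_contDiffOn
    (hf : ContDiffOn ℝ 1 f (Ici (0 : ℝ) ×ˢ (univ : Set (Fin m → ℝ)))) {r : ℝ} (hr : 0 < r)
    (v : Fin m → ℝ) : DifferentiableAt ℝ f (r, v) :=
  (hf.differentiableOn one_ne_zero).differentiableAt
    (prod_mem_nhds (Ici_mem_nhds hr) Filter.univ_mem)

lemma partialU_eq_fderiv {r : ℝ} {v : Fin m → ℝ} (hf : DifferentiableAt ℝ f (r, v)) (j : Fin m) :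
    partialU f j r v = fderiv ℝ f (r, v) (0, Pi.single j 1) := by
  have h1 : HasDerivAt (fun t : ℝ => (r, Function.update v j t)) (0, Pi.single j 1) (v j) :=
    (hasDerivAt_const _ _).prodMk (hasDerivAt_update v j (v j))
  have h2 : HasFDerivAt f (fderiv ℝ f (r, v)) (r, Function.update v j (v j)) := by
    rw [Function.update_eq_self]; exact hf.hasFDerivAt
  exact (h2.comp_hasDerivAt (v j) h1).deriv

/-- A cooperative nonlinearity is strictly increasing in the off-diagonal variables. -/
lemma lt_of_cooperative (hf : ContDiffOn ℝ 1 f (Ici (0 : ℝ) ×ˢ (univ : Set (Fin m → ℝ))))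
    {i : Fin m} (hcoop : ∀ j, j ≠ i → ∀ (r : ℝ) (v : Fin m → ℝ), 0 < r → (∀ l, 0 < v l) →
      0 < partialU f j r v) {r : ℝ} (hr : 0 < r) {a b : Fin m → ℝ} (hb : ∀ l, 0 < b l)
    (hba : ∀ l, b l ≤ a l) (hi : a i = b i) (hne : ∃ l, b l < a l) : f (r, b) < f (r, a) := by
  -- Mean value theorem on the segment from `b` to `a`: it stays in the positive cone, where the
  -- coupling is positive, and its `i`-th coordinate is constant.
  set g : ℝ → ℝ := fun t => f (r, b + t • (a - b)) with hg
  have hder : ∀ t : ℝ, HasDerivAt g (fderiv ℝ f (r, b + t • (a - b)) (0, a - b)) t := by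
    intro t
    have h1 : HasDerivAt (fun t : ℝ => (r, b + t • (a - b))) (0, a - b) t := by
      refine (hasDerivAt_const _ _).prodMk ?_
      simpa using ((hasDerivAt_id t).smul_const (a - b)).const_add b
    exact (differentiableAt_of_contDiffOn hf hr _).hasFDerivAt.comp_hasDerivAt t h1
  obtain ⟨t, ht, heq⟩ := exists_hasDerivAt_eq_slope g _ zero_lt_one
    (fun t _ => (hder t).continuousAt.continuousWithinAt) fun t _ => hder t
  have e0 : g 0 = f (r, b) := by simp [hg]
  have e1 : g 1 = f (r, a) := by simp [hg]
  rw [e0, e1, sub_zero, div_one] at heq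
  set v := b + t • (a - b) with hv
  have hvpos : ∀ l, 0 < v l := fun l => by
    have : 0 ≤ t * (a l - b l) := mul_nonneg ht.1.le (sub_nonneg.2 (hba l))
    have := hb l
    simp only [hv, Pi.add_apply, Pi.smul_apply, Pi.sub_apply, smul_eq_mul]
    linarith
  have hsum : fderiv ℝ f (r, v) (0, a - b) = ∑ j, (a j - b j) * partialU f j r v := by
    have hdec : ((0 : ℝ), a - b) = ∑ j, (a j - b j) • ((0 : ℝ), (Pi.single j 1 : Fin m → ℝ)) := by
      refine Prod.ext ?_ ?_
      · simp [Prod.fst_sum]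
      · rw [Prod.snd_sum]
        simpa using pi_eq_sum_univ' (a - b)
    rw [hdec, map_sum]
    refine Finset.sum_congr rfl fun j _ => ?_
    rw [map_smul, smul_eq_mul, partialU_eq_fderiv (differentiableAt_of_contDiffOn hf hr v)]
  have hpos : 0 < ∑ j, (a j - b j) * partialU f j r v := by
    obtain ⟨l, hl⟩ := hne
    refine Finset.sum_pos' (fun j _ => ?_) ⟨l, Finset.mem_univ _, ?_⟩
    · by_cases hj : j = i
      · rw [hj, hi, sub_self, zero_mul]
      · exact mul_nonneg (sub_nonneg.2 (hba j)) (hcoop j hj r v hr hvpos).le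
    · have hli : l ≠ i := fun h => by rw [h, hi] at hl; exact lt_irrefl _ hl
      exact mul_pos (sub_pos.2 hl) (hcoop l hli r v hr hvpos)
  rw [← hsum, heq] at hpos
  linarith

/-- One-sided Lipschitz bound for a cooperative nonlinearity. -/
lemma exists_cooperative_lower_bound
    (hf : ContDiffOn ℝ 1 f (Ici (0 : ℝ) ×ˢ (univ : Set (Fin m → ℝ))))
    {i : Fin m} (hcoop : ∀ j, j ≠ i → ∀ (r : ℝ) (v : Fin m → ℝ), 0 < r → (∀ l, 0 < v l) →
      0 < partialU f j r v) (R M : ℝ) :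
    ∃ L : ℝ, 0 ≤ L ∧ ∀ r, 0 < r → r ≤ R → ∀ a b : Fin m → ℝ, (∀ l, 0 < a l ∧ a l ≤ M) →
      (∀ l, 0 < b l ∧ b l ≤ M) →
      -(L * (|a i - b i| + ∑ j, max (b j - a j) 0)) ≤ f (r, a) - f (r, b) := by
  obtain ⟨L, hL, hlip⟩ := exists_lipschitz_of_contDiffOn hf R M
  refine ⟨L, hL, fun r hr hR a b ha hb => ?_⟩
  have hM : 0 ≤ M := ((ha i).1.trans_le (ha i).2).le
  -- An intermediate state. Between `a` and `c` only coordinates other than `i` differ, so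
  -- cooperativity gives `f (r, c) ≤ f (r, a)`; the passage from `c` to `b` is paid for by the
  -- Lipschitz constant and changes coordinate `j ≠ i` only by the positive part of `b j - a j`.
  set c : Fin m → ℝ := fun j => if j = i then a i else min (a j) (b j) with hc
  have hci : c i = a i := if_pos rfl
  have hcj : ∀ j, j ≠ i → c j = min (a j) (b j) := fun j hj => if_neg hj
  have hcb : ∀ l, 0 < c l ∧ c l ≤ M := fun l => by
    by_cases hl : l = i
    · rw [hl, hci]; exact ha i
    · rw [hcj l hl]; exact ⟨lt_min (ha l).1 (hb l).1, (min_le_left _ _).trans (ha l).2⟩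
  have hca : ∀ l, c l ≤ a l := fun l => by
    by_cases hl : l = i
    · rw [hl, hci]
    · rw [hcj l hl]; exact min_le_left _ _
  have hnorm : ∀ v : Fin m → ℝ, (∀ l, 0 < v l ∧ v l ≤ M) → ‖v‖ ≤ M := fun v hv =>
    (pi_norm_le_iff_of_nonneg hM).2 fun l => by
      rw [Real.norm_of_nonneg (hv l).1.le]; exact (hv l).2
  have h1 : f (r, c) ≤ f (r, a) := by
    by_cases hne : ∃ l, c l < a l
    · exact (lt_of_cooperative hf hcoop hr (fun l => (hcb l).1) hca hci.symm hne).le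
    · push Not at hne
      rw [show c = a from funext fun l => le_antisymm (hca l) (hne l)]
  have h2 := (abs_le.1 (hlip r hr.le hR c b (hnorm c hcb) (hnorm b hb))).1
  have hs : 0 ≤ ∑ j, max (b j - a j) 0 := Finset.sum_nonneg fun j _ => le_max_right _ _
  have h3 : ‖c - b‖ ≤ |a i - b i| + ∑ j, max (b j - a j) 0 := by
    refine (pi_norm_le_iff_of_nonneg (add_nonneg (abs_nonneg _) hs)).2 fun l => ?_
    rw [Pi.sub_apply, Real.norm_eq_abs]
    by_cases hl : l = i
    · rw [hl, hci]; linarith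
    · have h4 : max (b l - a l) 0 ≤ ∑ j, max (b j - a j) 0 :=
        Finset.single_le_sum (f := fun j => max (b j - a j) 0)
          (fun j _ => le_max_right _ _) (Finset.mem_univ l)
      have h5 : |c l - b l| ≤ max (b l - a l) 0 := by
        rw [hcj l hl, abs_sub_comm, abs_of_nonneg (sub_nonneg.2 (min_le_right _ _))]
        rcases min_choice (a l) (b l) with h | h <;> rw [h]
        · exact le_max_left _ _
        · rw [sub_self]; exact le_max_right _ _
      linarith [abs_nonneg (a i - b i)]
  have h4 := mul_le_mul_of_nonneg_left h3 hL
  linarith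

end nonlinearity

set_option linter.unusedSectionVars false

/-! ### Translation of the weak formulation -/

section weakForm

variable {N : ℕ} [NeZero N] {k₀ : ℝ → ℝ≥0∞} {u v : Space N → ℝ} {Ω : Set (Space N)}

/-- Off the diagonal `k₀` is finite, and each slice of the diagonal is a null set. -/
lemma energyENN_eq (hk : IsKernelProfile N k₀) (hu : Measurable u) :
    energyENN k₀ u = ∫⁻ p : Space N × Space N,
      ENNReal.ofReal ((u p.1 - u p.2) ^ 2 * (k₀ ‖p.1 - p.2‖).toReal) := by
  have hm : Measurable fun p : Space N × Space N =>
      ENNReal.ofReal ((u p.1 - u p.2) ^ 2 * (k₀ ‖p.1 - p.2‖).toReal) :=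
    ((((hu.comp measurable_fst).sub (hu.comp measurable_snd)).pow_const 2).mul
      hk.realProfile.meas_sub).ennreal_ofReal
  rw [Measure.volume_eq_prod, lintegral_prod _ hm.aemeasurable]
  refine lintegral_congr fun x => lintegral_congr_ae ?_
  have : ∀ᵐ y : Space N, y ≠ x := compl_mem_ae_iff.2 (measure_singleton x)
  filter_upwards [this] with y hy
  have hpos : 0 < ‖x - y‖ := norm_pos_iff.2 (sub_ne_zero.2 hy.symm)
  rw [ENNReal.ofReal_mul (sq_nonneg _), ENNReal.ofReal_toReal (hk.ne_top hpos)]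

lemma finEnergy_iff (hk : IsKernelProfile N k₀) (hu : Measurable u) :
    FinEnergy (fun r => (k₀ r).toReal) u ↔ energyENN k₀ u < ∞ := by
  rw [energyENN_eq hk hu]
  have h0 : ∀ p : Space N × Space N, 0 ≤ (u p.1 - u p.2) ^ 2 * (k₀ ‖p.1 - p.2‖).toReal :=
    fun p => mul_nonneg (sq_nonneg _) ENNReal.toReal_nonneg
  rw [← hasFiniteIntegral_iff_ofReal (Filter.Eventually.of_forall h0)]
  refine ⟨fun h => h.integrable.2, fun h => ⟨hu, ?_, h⟩⟩
  exact ((((hu.comp measurable_fst).sub (hu.comp measurable_snd)).pow_const 2).mul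
      hk.realProfile.meas_sub).aestronglyMeasurable

lemma bilin_eq_form (hk : IsKernelProfile N k₀) (hu : FinEnergy (fun r => (k₀ r).toReal) u)
    (hv : FinEnergy (fun r => (k₀ r).toReal) v) :
    bilin k₀ u v = (1 / 2) * form (fun r => (k₀ r).toReal) u v := by
  have := hu.integrable_mul hk.realProfile hv
  unfold bilin form
  rw [Measure.volume_eq_prod, integral_prod _ this]

lemma integrable_of_bounded (hΩ : MeasurableSet Ω) (hb : Bornology.IsBounded Ω)
    (hu : Measurable u) {C : ℝ} (hC : ∀ x ∈ Ω, |u x| ≤ C) (h0 : ∀ x, x ∉ Ω → u x = 0) :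
    Integrable u := by
  have : Integrable (Ω.indicator fun _ => C) := by
    rw [integrable_indicator_iff hΩ]
    exact integrableOn_const hb.measure_lt_top.ne
  refine this.mono' hu.aestronglyMeasurable (Filter.Eventually.of_forall fun x => ?_)
  by_cases hx : x ∈ Ω
  · rw [indicator_of_mem hx]; exact hC x hx
  · rw [indicator_of_notMem hx, h0 x hx, norm_zero]

lemma memD_of_finEnergy (hk : IsKernelProfile N k₀) (hΩ : MeasurableSet Ω)
    (hb : Bornology.IsBounded Ω) (hu : FinEnergy (fun r => (k₀ r).toReal) u) {C : ℝ}
    (hC : ∀ x, |u x| ≤ C) (h0 : ∀ x, x ∉ Ω → u x = 0) : MemD k₀ Ω u := by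
  refine ⟨?_, h0, (finEnergy_iff hk hu.meas).1 hu⟩
  rw [memLp_two_iff_integrable_sq hu.meas.aestronglyMeasurable]
  refine integrable_of_bounded hΩ hb (hu.meas.pow_const 2) (C := C ^ 2) (fun x _ => ?_)
    fun x hx => by rw [h0 x hx, zero_pow two_ne_zero]
  rw [abs_pow]
  exact pow_le_pow_left₀ (abs_nonneg _) (hC x) 2

end weakForm

/-! ### Reflected differences of a positive solution -/

/-- The standing assumptions on the system and on its positive solution. -/
structure PositiveSolution {N m : ℕ} (k₀ : ℝ → ℝ≥0∞) (Ω : Set (Space N))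
    (f : Fin m → ℝ × (Fin m → ℝ) → ℝ) (u : Fin m → Space N → ℝ) : Prop where
  kernel : IsKernelProfile N k₀
  isOpen : IsOpen Ω
  conn : IsConnected Ω
  bdd : Bornology.IsBounded Ω
  radial : IsRadial Ω
  contDiff : ∀ i, ContDiffOn ℝ 1 (f i) (Ici (0 : ℝ) ×ˢ (univ : Set (Fin m → ℝ)))
  coop : ∀ i j : Fin m, i ≠ j → ∀ (r : ℝ) (v : Fin m → ℝ), 0 < r → (∀ l, 0 < v l) →
      0 < partialU (f j) i r v
  cont : ∀ i, Continuous (u i)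
  bounded : ∀ i, ∃ C : ℝ, ∀ x, |u i x| ≤ C
  sol : IsWeakSolution k₀ Ω f u
  pos : ∀ i, ∀ x ∈ Ω, 0 < u i x

/-- The right hand side of the `i`-th equation. -/
noncomputable def rhs {N m : ℕ} (f : Fin m → ℝ × (Fin m → ℝ) → ℝ) (u : Fin m → Space N → ℝ) (i : Fin m)
    (x : Space N) : ℝ :=
  f i (‖x‖, fun j => u j x)

/-- The difference of `u` and its reflection. -/
noncomputable def mirrorDiff {N : ℕ} (e : Space N) (u : Space N → ℝ) (x : Space N) : ℝ :=
  u x - u (mirror e x)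

namespace PositiveSolution

variable {N m : ℕ} [NeZero N] {k₀ : ℝ → ℝ≥0∞} {Ω : Set (Space N)}
  {f : Fin m → ℝ × (Fin m → ℝ) → ℝ} {u : Fin m → Space N → ℝ} {e : Space N}

lemma finEnergy (S : PositiveSolution k₀ Ω f u) (i : Fin m) :
    FinEnergy (fun r => (k₀ r).toReal) (u i) :=
  (finEnergy_iff S.kernel (S.cont i).measurable).2 (S.sol i).1.energy_lt_top

lemma eq_zero (S : PositiveSolution k₀ Ω f u) (i : Fin m) {x : Space N} (hx : x ∉ Ω) : u i x = 0 :=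
  (S.sol i).1.eq_zero x hx

lemma mirror_mem (S : PositiveSolution k₀ Ω f u) {x : Space N} :
    mirror e x ∈ Ω ↔ x ∈ Ω :=
  ⟨fun h => S.radial _ _ (LinearIsometryEquiv.norm_map _ _) h,
    fun h => S.radial _ _ (LinearIsometryEquiv.norm_map _ _).symm h⟩

lemma finEnergy_mirrorDiff (S : PositiveSolution k₀ Ω f u) (i : Fin m) :
    FinEnergy (fun r => (k₀ r).toReal) (mirrorDiff e (u i)) :=
  (S.finEnergy i).sub S.kernel.realProfile ((S.finEnergy i).comp_isometry (mirror e))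

lemma continuous_mirrorDiff (S : PositiveSolution k₀ Ω f u) (i : Fin m) :
    Continuous (mirrorDiff e (u i)) :=
  (S.cont i).sub ((S.cont i).comp (mirror e).continuous)

lemma mirrorDiff_odd (u : Space N → ℝ) (x : Space N) :
    mirrorDiff e u (mirror e x) = -mirrorDiff e u x :=
  sub_mirror_odd u x

lemma mirrorDiff_eq_zero (S : PositiveSolution k₀ Ω f u) (i : Fin m) {x : Space N} (hx : x ∉ Ω) :
    mirrorDiff e (u i) x = 0 := by
  rw [mirrorDiff, S.eq_zero i hx, S.eq_zero i (mt S.mirror_mem.1 hx), sub_zero]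

lemma continuous_rhs (S : PositiveSolution k₀ Ω f u) (i : Fin m) : Continuous (rhs f u i) := by
  have h : Continuous fun x : Space N => (‖x‖, fun j => u j x) :=
    continuous_norm.prodMk (continuous_pi S.cont)
  exact (S.contDiff i).continuousOn.comp_continuous h fun x => ⟨norm_nonneg x, mem_univ _⟩

lemma exists_rhs_bound (S : PositiveSolution k₀ Ω f u) (i : Fin m) :
    ∃ C, ∀ x ∈ Ω, |rhs f u i x| ≤ C := by
  obtain ⟨C, hC⟩ := S.bdd.isCompact_closure.exists_bound_of_continuousOn
    (S.continuous_rhs i).continuousOn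
  exact ⟨C, fun x hx => hC x (subset_closure hx)⟩

lemma integrable_rhs_mul (S : PositiveSolution k₀ Ω f u) (i : Fin m) {φ : Space N → ℝ}
    (hφ : Measurable φ) {C : ℝ} (hC : ∀ x, |φ x| ≤ C) (h0 : ∀ x, x ∉ Ω → φ x = 0) :
    Integrable fun x => rhs f u i x * φ x := by
  obtain ⟨D, hD⟩ := S.exists_rhs_bound i
  refine integrable_of_bounded S.isOpen.measurableSet S.bdd
    ((S.continuous_rhs i).measurable.mul hφ) (C := D * C) (fun x hx => ?_)
    fun x hx => by rw [h0 x hx, mul_zero]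
  rw [abs_mul]
  exact mul_le_mul (hD x hx) (hC x) (abs_nonneg _) ((abs_nonneg _).trans (hD x hx))

lemma integrable_rhs_mirror_mul (S : PositiveSolution k₀ Ω f u) (i : Fin m) {φ : Space N → ℝ}
    (hφ : Measurable φ) (hφa : ∀ x, φ (mirror e x) = -φ x) {C : ℝ} (hC : ∀ x, |φ x| ≤ C)
    (h0 : ∀ x, x ∉ Ω → φ x = 0) :
    Integrable fun x => rhs f u i (mirror e x) * φ x := by
  have := ((mirror e).measurePreserving.integrable_comp_emb
      (mirror e).toHomeomorph.measurableEmbedding).2 (S.integrable_rhs_mul i hφ hC h0)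
  refine this.neg.congr (Filter.Eventually.of_forall fun x => ?_)
  simp only [Pi.neg_apply, Function.comp_apply, hφa]
  ring

lemma integrable_mirrorDiff_rhs_mul (S : PositiveSolution k₀ Ω f u) (i : Fin m) {φ : Space N → ℝ}
    (hφ : Measurable φ) (hφa : ∀ x, φ (mirror e x) = -φ x) {C : ℝ} (hC : ∀ x, |φ x| ≤ C)
    (h0 : ∀ x, x ∉ Ω → φ x = 0) : Integrable fun x => mirrorDiff e (rhs f u i) x * φ x := by
  refine ((S.integrable_rhs_mul i hφ hC h0).sub
    (S.integrable_rhs_mirror_mul i hφ hφa hC h0)).congr (Filter.Eventually.of_forall fun x => ?_)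
  simp only [Pi.sub_apply, mirrorDiff]; ring

/-- The weak equation satisfied by the difference of `u i` and its reflection. -/
lemma form_mirrorDiff (S : PositiveSolution k₀ Ω f u) (i : Fin m) {φ : Space N → ℝ}
    (hφ : FinEnergy (fun r => (k₀ r).toReal) φ) (hφa : ∀ x, φ (mirror e x) = -φ x)
    {C : ℝ} (hC : ∀ x, |φ x| ≤ C) (h0 : ∀ x, x ∉ Ω → φ x = 0) :
    form (fun r => (k₀ r).toReal) (mirrorDiff e (u i)) φ
      = 2 * ∫ x, mirrorDiff e (rhs f u i) x * φ x := by
  have h1 := form_sub_mirror (e := e) S.kernel.realProfile (S.finEnergy i) hφ hφa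
  have h2 := (S.sol i).2 φ (memD_of_finEnergy S.kernel S.isOpen.measurableSet S.bdd hφ hC h0)
  rw [bilin_eq_form S.kernel (S.finEnergy i) hφ, setIntegral_eq_integral_of_forall_compl_eq_zero
    (fun x hx => by rw [h0 x hx, mul_zero])] at h2
  have i1 := S.integrable_rhs_mul i hφ.meas hC h0
  have i2 := S.integrable_rhs_mirror_mul i hφ.meas hφa hC h0
  have h3 : ∫ x, rhs f u i (mirror e x) * φ x = -∫ x, rhs f u i x * φ x := by
    rw [← integral_neg]
    refine Eq.trans ?_ ((mirror e).measurePreserving.integral_comp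
      (mirror e).toHomeomorph.measurableEmbedding _)
    congr 1; ext x
    rw [hφa]; ring
  have h4 : ∫ x, mirrorDiff e (rhs f u i) x * φ x = 2 * ∫ x, rhs f u i x * φ x := by
    have : ∫ x, mirrorDiff e (rhs f u i) x * φ x
        = (∫ x, rhs f u i x * φ x) - ∫ x, rhs f u i (mirror e x) * φ x := by
      rw [← integral_sub i1 i2]
      congr 1; ext x; rw [mirrorDiff]; ring
    rw [this, h3]; ring
  have h5 : (1 / 2) * form (fun r => (k₀ r).toReal) (u i) φ = ∫ x, rhs f u i x * φ x := h2
  -- With `w` the reflected difference and `F` the right-hand side: `form w φ = 2 form u φ = 4 ∫ F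
  -- φ`, and antisymmetrising `F` accounts for one factor `2`.
  rw [h4, ← h5]
  have h6 : form (fun r => (k₀ r).toReal) (mirrorDiff e (u i)) φ
    = 2 * form (fun r => (k₀ r).toReal) (u i) φ := h1
  rw [h6]; ring

lemma ne_zero_of_inner_pos {x e : Space N} (h : 0 < inner ℝ x e) : x ≠ 0 := by
  rintro rfl
  simp at h

/-- The bounds on `‖x‖` and `u j` are reflection invariant, so one `L` serves all directions `e`.
This later gives a single measure threshold valid for every `e`. -/
lemma exists_rhs_lower_bound (S : PositiveSolution k₀ Ω f u) :
    ∃ L : ℝ, 0 ≤ L ∧ ∀ i, ∀ x ∈ Ω, ∀ e : Space N, 0 < inner ℝ x e →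
      -(L * (|mirrorDiff e (u i) x| + ∑ j, max (-mirrorDiff e (u j) x) 0))
        ≤ mirrorDiff e (rhs f u i) x := by
  obtain ⟨R, hR⟩ := S.bdd.exists_norm_le
  choose C hC using S.bounded
  set M := ∑ i, |C i|
  have hM : ∀ i x, u i x ≤ M := fun i x =>
    (le_abs_self _).trans ((hC i x).trans ((le_abs_self _).trans
      (Finset.single_le_sum (f := fun i => |C i|) (fun _ _ => abs_nonneg _) (Finset.mem_univ i))))
  choose L hL0 hL using fun i => exists_cooperative_lower_bound (S.contDiff i)
    (fun j hj => S.coop j i hj) R M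
  refine ⟨∑ i, L i, Finset.sum_nonneg fun i _ => hL0 i, fun i x hx e he => ?_⟩
  have hx0 : 0 < ‖x‖ := norm_pos_iff.2 (ne_zero_of_inner_pos he)
  have h := hL i ‖x‖ hx0 (hR x hx) (fun j => u j x) (fun j => u j (mirror e x))
    (fun l => ⟨S.pos l x hx, hM l x⟩) fun l => ⟨S.pos l _ (S.mirror_mem.2 hx), hM l _⟩
  have e1 : mirrorDiff e (rhs f u i) x
      = f i (‖x‖, fun j => u j x) - f i (‖x‖, fun j => u j (mirror e x)) := by
    simp only [mirrorDiff, rhs, LinearIsometryEquiv.norm_map]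
  have hle : L i ≤ ∑ i, L i :=
    Finset.single_le_sum (f := L) (fun i _ => hL0 i) (Finset.mem_univ i)
  rw [e1]
  refine le_trans ?_ h
  simp only [mirrorDiff, neg_sub]
  have hs : 0 ≤ |u i x - u i (mirror e x)| + ∑ j, max (u j (mirror e x) - u j x) 0 :=
    add_nonneg (abs_nonneg _) (Finset.sum_nonneg fun j _ => le_max_right _ _)
  exact neg_le_neg (mul_le_mul_of_nonneg_right hle hs)

/-- Strict coupling: it prevents one component from being symmetric while another is not. -/
lemma mirrorDiff_rhs_pos (S : PositiveSolution k₀ Ω f u) {i : Fin m} {x : Space N} (hx : x ∈ Ω)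
    (he : 0 < inner ℝ x e) (hle : ∀ j, 0 ≤ mirrorDiff e (u j) x) (hi : mirrorDiff e (u i) x = 0)
    (hne : ∃ j, 0 < mirrorDiff e (u j) x) : 0 < mirrorDiff e (rhs f u i) x := by
  have hx0 : 0 < ‖x‖ := norm_pos_iff.2 (ne_zero_of_inner_pos he)
  obtain ⟨j, hj⟩ := hne
  have := lt_of_cooperative (S.contDiff i) (fun j hj => S.coop j i hj) hx0
    (a := fun j => u j x) (b := fun j => u j (mirror e x))
    (fun l => S.pos l _ (S.mirror_mem.2 hx)) (fun l => sub_nonneg.1 (hle l)) (sub_eq_zero.1 hi)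
    ⟨j, sub_pos.1 hj⟩
  simp only [mirrorDiff, rhs, LinearIsometryEquiv.norm_map]
  exact sub_pos.2 this

lemma exists_mirrorDiff_bound (S : PositiveSolution k₀ Ω f u) (i : Fin m) :
    ∃ C, ∀ x, |mirrorDiff e (u i) x| ≤ C := by
  obtain ⟨C, hC⟩ := S.bounded i
  refine ⟨C + C, fun x => (abs_sub _ _).trans (add_le_add (hC _) (hC _))⟩

end PositiveSolution

/-! ### Maximum principles for the system -/

lemma continuous_inner_left {N : ℕ} (e : Space N) : Continuous fun x : Space N => inner ℝ x e := by
  fun_prop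

/-- The half of a radial connected set on one side of a hyperplane through the origin is
connected. -/
lemma isPreconnected_half {N : ℕ} {Ω : Set (Space N)} (hc : IsPreconnected Ω) (hr : IsRadial Ω)
    (e : Space N) : IsPreconnected {x | x ∈ Ω ∧ 0 < inner ℝ x e} := by
  set J := norm '' Ω ∩ Ioi 0
  have hJ : IsPreconnected J :=
    ((hc.image _ continuous_norm.continuousOn).ordConnected.inter ordConnected_Ioi).isPreconnected
  have hH : IsPreconnected {v : Space N | 0 < inner ℝ v e} :=
    (convex_halfSpace_gt (IsLinearMap.mk (fun x y => inner_add_left x y e)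
      fun c x => by simp [inner_smul_left]) 0).isPreconnected
  have hne : ∀ v : Space N, 0 < inner ℝ v e → ‖v‖ ≠ 0 := fun v hv => by
    rw [norm_ne_zero_iff]; rintro rfl; simp at hv
  -- The half is the image of an interval of positive radii times an open half space under `(r, v) ↦
  -- r v / ‖v‖`.
  have himg := (hJ.prod hH).image (fun p : ℝ × Space N => (p.1 / ‖p.2‖) • p.2)
    ((continuousOn_fst.div (continuous_norm.comp continuous_snd).continuousOn
      fun p hp => hne _ hp.2).smul continuousOn_snd)
  convert himg using 1
  ext x
  constructor
  · rintro ⟨hx, hxe⟩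
    have h0 := hne x hxe
    refine ⟨(‖x‖, x), ⟨⟨⟨x, hx, rfl⟩, ?_⟩, hxe⟩, ?_⟩
    · exact lt_of_le_of_ne (norm_nonneg x) h0.symm
    · simp [div_self h0]
  · rintro ⟨⟨r, v⟩, ⟨⟨⟨y, hy, hyr⟩, hr0⟩, hv⟩, rfl⟩
    simp only at hv hyr hr0 ⊢
    have h0 := hne v hv
    have hr0' : 0 < r := hr0
    have hv0 : 0 < ‖v‖ := lt_of_le_of_ne (norm_nonneg v) h0.symm
    refine ⟨hr y _ ?_ hy, ?_⟩
    · rw [norm_smul, Real.norm_of_nonneg (by positivity), hyr, div_mul_cancel₀ _ h0]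
    · rw [inner_smul_left]
      simp only [conj_trivial]
      exact mul_pos (by positivity) hv

namespace PositiveSolution

variable {N m : ℕ} [NeZero N] {k₀ : ℝ → ℝ≥0∞} {Ω : Set (Space N)}
  {f : Fin m → ℝ × (Fin m → ℝ) → ℝ} {u : Fin m → Space N → ℝ} {e : Space N}

lemma isOpen_half (S : PositiveSolution k₀ Ω f u) : IsOpen {x | x ∈ Ω ∧ 0 < inner ℝ x e} :=
  S.isOpen.inter (isOpen_lt continuous_const (continuous_inner_left e))

lemma exists_ball_half (S : PositiveSolution k₀ Ω f u) {a : Space N} (ha : a ∈ Ω)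
    (hae : 0 < inner ℝ a e) :
    ∃ r, 0 < r ∧ ∀ x, ‖x - a‖ < r → x ∈ Ω ∧ 0 < inner ℝ x e := by
  obtain ⟨r, hr, h⟩ := Metric.isOpen_iff.1 (S.isOpen_half (e := e)) a ⟨ha, hae⟩
  exact ⟨r, hr, fun x hx => h (by rwa [Metric.mem_ball, dist_eq_norm])⟩

/-- When all differences are nonnegative in the half space, the coupling terms of the lower bound
vanish and each component is separately a supersolution. The constant `2 * L` reflects the factor in
`form_mirrorDiff`. -/
lemma eventually_mirrorDiff_eq_zero (S : PositiveSolution k₀ Ω f u) (he : e ≠ 0)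
    (hpos : ∀ i x, 0 < inner ℝ x e → 0 ≤ mirrorDiff e (u i) x) (i : Fin m) {x₀ : Space N}
    (hx₀ : x₀ ∈ Ω) (hx₀e : 0 < inner ℝ x₀ e) (h0 : mirrorDiff e (u i) x₀ = 0) :
    ∀ᶠ y in nhds x₀, mirrorDiff e (u i) y = 0 := by
  obtain ⟨L, hL, hlow⟩ := S.exists_rhs_lower_bound
  obtain ⟨R, hR, hball⟩ := S.exists_ball_half hx₀ hx₀e
  refine eventually_eq_zero_of_supersolution S.kernel.realProfile he (S.continuous_mirrorDiff i)
    (S.finEnergy_mirrorDiff i) (mirrorDiff_odd (u i)) (hpos i) hx₀e hR (L := 2 * L) (by positivity)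
    (fun φ hφ hφa hφs ⟨C, hC⟩ hsupp => ?_) h0
  have hout : ∀ x, x ∉ Ω → φ x = 0 := fun x hx => by
    by_contra hne
    rcases hsupp x hne with h | h
    · exact hx (hball x h).1
    · exact hx (S.mirror_mem.1 (hball _ h).1)
  rw [S.form_mirrorDiff i hφ hφa hC hout]
  have key : ∀ x, 0 < inner ℝ x e → -(L * (|mirrorDiff e (u i) x| * |φ x|))
      ≤ mirrorDiff e (rhs f u i) x * φ x := by
    intro x hx
    by_cases hxΩ : x ∈ Ω
    · have h1 := hlow i x hxΩ e hx
      have h2 : ∑ j, max (-mirrorDiff e (u j) x) 0 = 0 :=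
        Finset.sum_eq_zero fun j _ => max_eq_right (by linarith [hpos j x hx])
      rw [h2, add_zero] at h1
      have h3 := (hφs x).1 hx.le
      rw [abs_of_nonneg h3]
      have := mul_le_mul_of_nonneg_right h1 h3
      linarith
    · simp [hout x hxΩ]
  have key' : ∀ x, -(L * (|mirrorDiff e (u i) x| * |φ x|)) ≤ mirrorDiff e (rhs f u i) x * φ x := by
    intro x
    rcases lt_trichotomy (inner ℝ x e) 0 with hx | hx | hx
    · have := key (mirror e x) (by rw [inner_mirror he]; linarith)
      rw [mirrorDiff_odd, mirrorDiff_odd, hφa, abs_neg, abs_neg] at this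
      linarith
    · rw [odd_eq_zero hφa hx]; simp
    · exact key x hx
  have hint : Integrable fun x => |mirrorDiff e (u i) x| * |φ x| := by
    obtain ⟨D, hD⟩ := S.exists_mirrorDiff_bound (e := e) i
    refine integrable_of_bounded S.isOpen.measurableSet S.bdd
      ((S.continuous_mirrorDiff i).abs.measurable.mul hφ.meas.abs) (C := D * C) (fun x _ => ?_)
      fun x hx => by rw [hout x hx]; simp
    rw [abs_mul, abs_abs, abs_abs]
    exact mul_le_mul (hD x) (hC x) (abs_nonneg _) ((abs_nonneg _).trans (hD x))
  have h1 := integral_mono (hint.const_mul L).neg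
    (S.integrable_mirrorDiff_rhs_mul i hφ.meas hφa hC hout) key'
  rw [integral_neg' , integral_const_mul] at h1
  linarith

/-- Strong maximum principle for the reflected differences of a cooperative system. -/
lemma mirrorDiff_pos (S : PositiveSolution k₀ Ω f u) (he : e ≠ 0)
    (hpos : ∀ i x, 0 < inner ℝ x e → 0 ≤ mirrorDiff e (u i) x)
    (hne : ∃ i x, 0 < inner ℝ x e ∧ 0 < mirrorDiff e (u i) x) :
    ∀ i, ∀ x ∈ Ω, 0 < inner ℝ x e → 0 < mirrorDiff e (u i) x := by
  -- Interior zeros and points of positivity are two disjoint open sets covering the connected half.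
  have hdich : ∀ i, (∀ x ∈ Ω, 0 < inner ℝ x e → mirrorDiff e (u i) x = 0) ∨
      ∀ x ∈ Ω, 0 < inner ℝ x e → 0 < mirrorDiff e (u i) x := by
    intro i
    by_cases hz : ∃ x ∈ Ω, 0 < inner ℝ x e ∧ mirrorDiff e (u i) x = 0
    · left
      obtain ⟨x₀, hx₀, hx₀e, h0⟩ := hz
      have hsub := (isPreconnected_half S.conn.isPreconnected S.radial e).subset_left_of_subset_union
        (v := {x | 0 < mirrorDiff e (u i) x})
        (isOpen_setOfPred_eventually_nhds (p := fun y => mirrorDiff e (u i) y = 0))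
        (isOpen_lt continuous_const (S.continuous_mirrorDiff i)) ?_ ?_ ?_
      · exact fun x hx hxe => (hsub ⟨hx, hxe⟩ : ∀ᶠ y in nhds x, mirrorDiff e (u i) y = 0).self_of_nhds
      · rw [Set.disjoint_left]
        intro x hx hx'
        have hx1 : ∀ᶠ y in nhds x, mirrorDiff e (u i) y = 0 := hx
        have hx2 : 0 < mirrorDiff e (u i) x := hx'
        rw [hx1.self_of_nhds] at hx2
        exact lt_irrefl _ hx2
      · rintro x ⟨hx, hxe⟩
        rcases (hpos i x hxe).eq_or_lt with h | h
        · exact Or.inl (S.eventually_mirrorDiff_eq_zero he hpos i hx hxe h.symm)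
        · exact Or.inr h
      · exact ⟨x₀, ⟨hx₀, hx₀e⟩, S.eventually_mirrorDiff_eq_zero he hpos i hx₀ hx₀e h0⟩
    · right
      push Not at hz
      exact fun x hx hxe => lt_of_le_of_ne (hpos i x hxe) (hz x hx hxe).symm
  obtain ⟨j, a, hae, ha⟩ := hne
  have haΩ : a ∈ Ω := by
    by_contra h
    rw [S.mirrorDiff_eq_zero j h] at ha
    exact lt_irrefl _ ha
  have hj : ∀ x ∈ Ω, 0 < inner ℝ x e → 0 < mirrorDiff e (u j) x :=
    (hdich j).resolve_left fun h => ha.ne' (h a haΩ hae)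
  intro i
  refine (hdich i).resolve_left fun hzero => ?_
  -- If component `i` is symmetric on the half, it is so everywhere, and the left side of its
  -- equation vanishes; strict coupling with component `j` makes the right side positive against an
  -- odd bump.
  have hall : ∀ x, mirrorDiff e (u i) x = 0 := by
    have hH : ∀ x, 0 < inner ℝ x e → mirrorDiff e (u i) x = 0 := fun x hx => by
      by_cases hxΩ : x ∈ Ω
      · exact hzero x hxΩ hx
      · exact S.mirrorDiff_eq_zero i hxΩ
    intro x
    rcases lt_trichotomy (inner ℝ x e) 0 with hx | hx | hx
    · have := hH (mirror e x) (by rw [inner_mirror he]; linarith)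
      rw [mirrorDiff_odd] at this
      linarith
    · exact odd_eq_zero (mirrorDiff_odd (u i)) hx
    · exact hH x hx
  obtain ⟨r, hr, hball⟩ := S.exists_ball_half haΩ hae
  have hK := S.kernel.realProfile
  set φ : Space N → ℝ := fun x => bump a r x - bump a r (mirror e x) with hφ
  have hφE : FinEnergy (fun r => (k₀ r).toReal) φ := (finEnergy_bump hK hr.le).sub hK
    ((finEnergy_bump hK hr.le).comp_isometry (mirror e))
  have hφa : ∀ x, φ (mirror e x) = -φ x := sub_mirror_odd _
  have hφc : Continuous φ := continuous_bump.sub (continuous_bump.comp (mirror e).continuous)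
  have hφb : ∀ x, |φ x| ≤ r ^ 2 := fun x => by
    rw [abs_le]
    constructor <;> simp only [hφ] <;> linarith [bump_nonneg (a := a) (r := r) x,
      bump_le (a := a) (r := r) x, bump_nonneg (a := a) (r := r) (mirror e x),
      bump_le (a := a) (r := r) (mirror e x)]
  have hφH : ∀ x, 0 < inner ℝ x e → φ x = bump a r x := fun x hx => by
    simp only [hφ, bump_mirror_eq_zero he hr.le (fun x hx => (hball x hx).2) hx, sub_zero]
  have hout : ∀ x, x ∉ Ω → φ x = 0 := fun x hx => by
    have b : ∀ y, y ∉ Ω → bump a r y = 0 := fun y hy => by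
      by_contra hne
      exact hy (hball y (bump_ne_zero hr.le hne)).1
    simp only [hφ, b x hx, b _ (mt S.mirror_mem.1 hx), sub_zero]
  have hform := S.form_mirrorDiff i hφE hφa hφb hout
  have hform0 : form (fun r => (k₀ r).toReal) (mirrorDiff e (u i)) φ = 0 := by
    unfold form
    simp [hall]
  have hrhs : ∀ x ∈ Ω, 0 < inner ℝ x e → 0 < mirrorDiff e (rhs f u i) x := fun x hx hxe =>
    S.mirrorDiff_rhs_pos hx hxe (fun l => hpos l x hxe) (hall x) ⟨j, hj x hx hxe⟩
  have hnn : ∀ x, 0 ≤ mirrorDiff e (rhs f u i) x * φ x := by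
    have hH : ∀ x, 0 < inner ℝ x e → 0 ≤ mirrorDiff e (rhs f u i) x * φ x := fun x hx => by
      by_cases hxΩ : x ∈ Ω
      · rw [hφH x hx]
        exact mul_nonneg (hrhs x hxΩ hx).le (bump_nonneg x)
      · rw [hout x hxΩ, mul_zero]
    intro x
    rcases lt_trichotomy (inner ℝ x e) 0 with hx | hx | hx
    · have := hH (mirror e x) (by rw [inner_mirror he]; linarith)
      rw [mirrorDiff_odd, hφa] at this
      linarith
    · rw [odd_eq_zero hφa hx, mul_zero]
    · exact hH x hx
  have hc : Continuous fun x => mirrorDiff e (rhs f u i) x * φ x :=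
    ((S.continuous_rhs i).sub ((S.continuous_rhs i).comp (mirror e).continuous)).mul hφc
  have hI : 0 < ∫ x, mirrorDiff e (rhs f u i) x * φ x := by
    refine (integral_pos_iff_support_of_nonneg hnn
      (S.integrable_mirrorDiff_rhs_mul i hφE.meas hφa hφb hout)).2
      (hc.isOpen_support.measure_pos _ ⟨a, ?_⟩)
    have h1 : 0 < φ a := by
      rw [hφH a hae]; exact bump_pos (by simpa using hr)
    exact (mul_pos (hrhs a haΩ hae) h1).ne'
  linarith

/-- The set where some reflected difference has the wrong sign. -/
def wrongSign {N m : ℕ} (Ω : Set (Space N)) (u : Fin m → Space N → ℝ) (e : Space N) :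
    Set (Space N) :=
  {x | x ∈ Ω ∧ ∃ i, (0 < inner ℝ x e ∧ mirrorDiff e (u i) x < 0) ∨
    (inner ℝ x e < 0 ∧ 0 < mirrorDiff e (u i) x)}

lemma measurableSet_wrongSign (S : PositiveSolution k₀ Ω f u) :
    MeasurableSet (wrongSign Ω u e) := by
  have : wrongSign Ω u e = Ω ∩ ⋃ i, (({x | 0 < inner ℝ x e} ∩ {x | mirrorDiff e (u i) x < 0}) ∪
      ({x | inner ℝ x e < 0} ∩ {x | 0 < mirrorDiff e (u i) x})) := by
    ext x; simp [wrongSign]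
  rw [this]
  have hi := continuous_inner_left e
  exact (S.isOpen.inter (isOpen_iUnion fun i =>
    ((isOpen_lt continuous_const hi).inter
      (isOpen_lt (S.continuous_mirrorDiff i) continuous_const)).union
    ((isOpen_lt hi continuous_const).inter
      (isOpen_lt continuous_const (S.continuous_mirrorDiff i))))).measurableSet

/-- Weak maximum principle: if the reflected differences have the wrong sign only on a set of
small measure, then they are nonnegative. -/
lemma mirrorDiff_nonneg_of_small (S : PositiveSolution k₀ Ω f u) :
    ∃ ε : ℝ≥0∞, 0 < ε ∧ ∀ e : Space N, e ≠ 0 → volume (wrongSign Ω u e) ≤ ε →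
      ∀ i x, 0 < inner ℝ x e → 0 ≤ mirrorDiff e (u i) x := by
  obtain ⟨L, hL, hlow⟩ := S.exists_rhs_lower_bound
  have hK := S.kernel.realProfile
  -- Summed over the components, the right-hand sides contribute `2 * L + 2 * (m * L)` times the
  -- total squared norm; the Poincaré constant exceeds this by `1`.
  obtain ⟨ε, hε, hP⟩ := hK.poincare (2 * L + 2 * (m * L) + 1)
  refine ⟨ε, hε, fun e he hvol => ?_⟩
  set φ : Fin m → Space N → ℝ := fun i => oddNegPart e (mirrorDiff e (u i)) with hφ
  have hwa : ∀ i x, mirrorDiff e (u i) (mirror e x) = -mirrorDiff e (u i) x :=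
    fun i => mirrorDiff_odd (u i)
  have hφE : ∀ i, FinEnergy (fun r => (k₀ r).toReal) (φ i) := fun i =>
    finEnergy_oddNegPart hK he (S.finEnergy_mirrorDiff i) (hwa i)
  have hφa : ∀ i x, φ i (mirror e x) = -φ i x := fun i => oddNegPart_mirror he (hwa i)
  choose C hC using fun i => S.exists_mirrorDiff_bound (e := e) i
  have hφb : ∀ i x, |φ i x| ≤ C i := fun i x =>
    (abs_oddNegPart_le e (mirrorDiff e (u i)) x).trans (hC i x)
  have hout : ∀ i x, x ∉ Ω → φ i x = 0 := fun i x hx => by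
    have := abs_oddNegPart_le e (mirrorDiff e (u i)) x
    rw [S.mirrorDiff_eq_zero i hx, abs_zero] at this
    exact abs_nonpos_iff.1 this
  have hφH : ∀ i x, 0 < inner ℝ x e → φ i x = max (-mirrorDiff e (u i) x) 0 :=
    fun i x hx => oddNegPart_of_pos hx
  have hbad : ∀ i x, x ∉ wrongSign Ω u e → φ i x = 0 := by
    intro i x hx
    by_cases hxΩ : x ∈ Ω
    · have hx' : ∀ i, ¬ ((0 < inner ℝ x e ∧ mirrorDiff e (u i) x < 0) ∨
          (inner ℝ x e < 0 ∧ 0 < mirrorDiff e (u i) x)) := fun i h => hx ⟨hxΩ, i, h⟩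
      have hxi := hx' i
      push Not at hxi
      rcases lt_trichotomy (inner ℝ x e) 0 with h | h | h
      · simp only [hφ]
        rw [oddNegPart_of_neg h, max_eq_right (hxi.2 h), neg_zero]
      · exact oddNegPart_of_eq h
      · rw [hφH i x h, max_eq_right (by linarith [hxi.1 h])]
    · exact hout i x hxΩ
  have hsq : ∀ i, Integrable fun x => φ i x ^ 2 := fun i =>
    integrable_of_bounded S.isOpen.measurableSet S.bdd ((hφE i).meas.pow_const 2) (C := C i ^ 2)
      (fun x _ => by rw [abs_pow]; exact pow_le_pow_left₀ (abs_nonneg _) (hφb i x) 2)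
      fun x hx => by rw [hout i x hx, zero_pow two_ne_zero]
  -- Where `φ i ≠ 0` on the half space, `φ i` equals the absolute value of the difference; the mixed
  -- products `φ j * φ i` are split by the arithmetic-geometric inequality.
  have hpt : ∀ i x, -(mirrorDiff e (rhs f u i) x * φ i x)
      ≤ L * φ i x ^ 2 + L / 2 * ∑ j, (φ j x ^ 2 + φ i x ^ 2) := by
    intro i
    have hs0 : ∀ x, 0 ≤ L * φ i x ^ 2 + L / 2 * ∑ j, (φ j x ^ 2 + φ i x ^ 2) := fun x =>
      add_nonneg (by positivity) (mul_nonneg (by positivity)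
        (Finset.sum_nonneg fun j _ => by positivity))
    have hH : ∀ x, 0 < inner ℝ x e → -(mirrorDiff e (rhs f u i) x * φ i x)
      ≤ L * φ i x ^ 2 + L / 2 * ∑ j, (φ j x ^ 2 + φ i x ^ 2) := by
      intro x hx
      by_cases hne : φ i x = 0
      · have := hs0 x
        rw [hne] at this ⊢
        rw [mul_zero, neg_zero]; exact this
      have hxΩ : x ∈ Ω := by
        by_contra h; exact hne (hout i x h)
      have h1 := hlow i x hxΩ e hx
      have h2 : 0 ≤ φ i x := by rw [hφH i x hx]; exact le_max_right _ _
      have h3 : |mirrorDiff e (u i) x| = φ i x := by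
        rcases oddNegPart_eq_or e (mirrorDiff e (u i)) x with h | h
        · exact absurd h hne
        · have h' : φ i x = -mirrorDiff e (u i) x := h
          rw [h', abs_of_nonpos (by linarith)]
      have h4 : ∑ j, max (-mirrorDiff e (u j) x) 0 = ∑ j, φ j x :=
        Finset.sum_congr rfl fun j _ => (hφH j x hx).symm
      rw [h3, h4] at h1
      have h5 := mul_le_mul_of_nonneg_right h1 h2
      have h6 : (∑ j, φ j x) * φ i x ≤ (1 / 2) * ∑ j, (φ j x ^ 2 + φ i x ^ 2) := by
        rw [Finset.sum_mul, Finset.mul_sum]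
        exact Finset.sum_le_sum fun j _ => by nlinarith [sq_nonneg (φ j x - φ i x)]
      have h7 := mul_le_mul_of_nonneg_left h6 hL
      linarith
    intro x
    rcases lt_trichotomy (inner ℝ x e) 0 with hx | hx | hx
    · have := hH (mirror e x) (by rw [inner_mirror he]; linarith)
      simpa only [mirrorDiff_odd, hφa, neg_mul_neg, neg_sq] using this
    · have h0 : φ i x = 0 := oddNegPart_of_eq hx
      have := hs0 x
      rw [h0] at this ⊢
      rw [mul_zero, neg_zero]; exact this
    · exact hH x hx
  set s : Fin m → ℝ := fun i => ∫ x, φ i x ^ 2 with hs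
  have hs0 : ∀ i, 0 ≤ s i := fun i => integral_nonneg fun x => sq_nonneg _
  have hineq : ∀ i, (2 * L + 2 * (m * L) + 1) * s i ≤ 2 * L * s i + L * ∑ j, (s j + s i) := by
    intro i
    have h1 := hP _ S.measurableSet_wrongSign hvol (φ i) (hφE i) (hbad i) (hsq i)
    have h2 := form_oddNegPart_le hK he (S.finEnergy_mirrorDiff i) (hwa i)
    have h3 := S.form_mirrorDiff i (hφE i) (hφa i) (hφb i) (hout i)
    have i1 : Integrable fun x => L / 2 * ∑ j, (φ j x ^ 2 + φ i x ^ 2) :=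
      (integrable_finsetSum _ fun j _ => (hsq j).add (hsq i)).const_mul _
    have h4 : ∫ x, -(mirrorDiff e (rhs f u i) x * φ i x)
        ≤ ∫ x, (L * φ i x ^ 2 + L / 2 * ∑ j, (φ j x ^ 2 + φ i x ^ 2)) :=
      integral_mono (S.integrable_mirrorDiff_rhs_mul i (hφE i).meas (hφa i) (hφb i) (hout i)).neg
        (((hsq i).const_mul L).add i1) (hpt i)
    rw [integral_neg, integral_add ((hsq i).const_mul L) i1, integral_const_mul,
      integral_const_mul] at h4
    have h5 : ∫ x, ∑ j, (φ j x ^ 2 + φ i x ^ 2) = ∑ j, (s j + s i) := by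
      rw [integral_finsetSum Finset.univ (f := fun j x => φ j x ^ 2 + φ i x ^ 2)
        fun j _ => (hsq j).add (hsq i)]
      exact Finset.sum_congr rfl fun j _ => integral_add (hsq j) (hsq i)
    rw [h5] at h4
    change form _ (φ i) (φ i) ≤ -form _ _ (φ i) at h2
    change _ ≤ L * s i + _ at h4
    change _ * s i ≤ _ at h1
    linarith
  have hsum : ∑ i, s i = 0 := by
    have h1 := Finset.sum_le_sum fun i (_ : i ∈ Finset.univ) => hineq i
    simp only [Finset.sum_add_distrib, ← Finset.mul_sum, Finset.sum_const, Finset.card_univ,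
      Fintype.card_fin, nsmul_eq_mul] at h1
    have h2 : 0 ≤ ∑ i, s i := Finset.sum_nonneg fun i _ => hs0 i
    nlinarith
  intro i x hx
  have hsi : s i = 0 := (Finset.sum_eq_zero_iff_of_nonneg fun i _ => hs0 i).1 hsum i
    (Finset.mem_univ i)
  by_contra! hneg
  have hpos : 0 < s i := by
    refine (integral_pos_iff_support_of_nonneg (fun x => sq_nonneg _) (hsq i)).2 ?_
    have hopen : IsOpen {x : Space N | 0 < inner ℝ x e ∧ mirrorDiff e (u i) x < 0} :=
      (isOpen_lt continuous_const (continuous_inner_left e)).inter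
        (isOpen_lt (S.continuous_mirrorDiff i) continuous_const)
    refine (hopen.measure_pos volume ⟨x, hx, hneg⟩).trans_le (measure_mono fun y hy => ?_)
    have : 0 < φ i y := by
      rw [hφH i y hy.1]; exact lt_max_of_lt_left (neg_pos.2 hy.2)
    exact (pow_pos this 2).ne'
  linarith

/-! ### Dominating directions and the first moment -/

lemma continuousAt_mirrorDiff_left (S : PositiveSolution k₀ Ω f u) (i : Fin m) (x : Space N)
    (he : e ≠ 0) : ContinuousAt (fun e => mirrorDiff e (u i) x) e := by
  have h1 : ContinuousAt (fun e : Space N => mirror e x) e := by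
    simp only [mirror_apply]
    have hn : ‖e‖ ^ 2 ≠ 0 := by positivity
    have h2 : ContinuousAt (fun e : Space N => 2 * inner ℝ e x) e :=
      (by fun_prop : Continuous fun e : Space N => 2 * inner ℝ e x).continuousAt
    have h3 : ContinuousAt (fun e : Space N => ‖e‖ ^ 2) e :=
      (by fun_prop : Continuous fun e : Space N => ‖e‖ ^ 2).continuousAt
    exact continuousAt_const.sub ((h2.div h3 hn).smul continuousAt_id)
  exact continuousAt_const.sub ((S.cont i).continuousAt.comp h1)

lemma ae_inner_ne_zero (he : e ≠ 0) : ∀ᵐ x : Space N, inner ℝ x e ≠ 0 := by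
  have hne : (Submodule.span ℝ {e})ᗮ ≠ ⊤ := by
    intro h
    have : e ∈ (Submodule.span ℝ {e})ᗮ := h ▸ Submodule.mem_top
    rw [Submodule.mem_orthogonal_singleton_iff_inner_left, inner_self_eq_zero] at this
    exact he this
  have h0 := Measure.addHaar_submodule (volume : Measure (Space N)) _ hne
  refine measure_mono_null (fun x hx => ?_) h0
  have hx' : inner ℝ x e = 0 := by simpa using hx
  exact Submodule.mem_orthogonal_singleton_iff_inner_left.2 hx'

lemma exists_mem_half (S : PositiveSolution k₀ Ω f u) (he : e ≠ 0) :
    ∃ x ∈ Ω, 0 < inner ℝ x e := by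
  obtain ⟨a, ha, hae⟩ : ∃ a ∈ Ω, inner ℝ a e ≠ 0 := by
    by_contra! h
    have h0 : volume Ω = 0 := measure_mono_null (fun x hx => by simpa using h x hx)
      (ae_iff.1 (ae_inner_ne_zero he))
    exact (S.isOpen.measure_pos volume S.conn.nonempty).ne' h0
  rcases hae.lt_or_gt with h | h
  · exact ⟨mirror e a, S.mirror_mem.2 ha, by rw [inner_mirror he]; linarith⟩
  · exact ⟨a, ha, h⟩

/-- The directions along which all components strictly dominate their reflections. -/
def dominating {N m : ℕ} (Ω : Set (Space N)) (u : Fin m → Space N → ℝ) : Set (Space N) :=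
  {e | e ≠ 0 ∧ ∀ i, ∀ x ∈ Ω, 0 < inner ℝ x e → 0 < mirrorDiff e (u i) x}

lemma nonneg_of_dominating (S : PositiveSolution k₀ Ω f u) (h : e ∈ dominating Ω u) (i : Fin m)
    {x : Space N} (hx : 0 < inner ℝ x e) : 0 ≤ mirrorDiff e (u i) x := by
  by_cases hxΩ : x ∈ Ω
  · exact (h.2 i x hxΩ hx).le
  · rw [S.mirrorDiff_eq_zero i hxΩ]

/-- For each fixed `x` off the hyperplane the strict inequalities at `e` persist for nearby `e'`.
All the sets lie in the bounded set `Ω`, so pointwise convergence of indicators suffices. -/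
lemma tendsto_volume_wrongSign (S : PositiveSolution k₀ Ω f u) (h : e ∈ dominating Ω u) :
    Filter.Tendsto (fun e' => volume (wrongSign Ω u e')) (nhds e) (nhds 0) := by
  rw [← measure_empty (μ := (volume : Measure (Space N)))]
  refine tendsto_measure_of_ae_tendsto_indicator (nhds e) MeasurableSet.empty
    (fun _ => S.measurableSet_wrongSign) S.isOpen.measurableSet S.bdd.measure_lt_top.ne
    (Filter.Eventually.of_forall fun _ x hx => hx.1) ?_
  filter_upwards [ae_inner_ne_zero h.1] with x hx
  by_cases hxΩ : x ∈ Ω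
  · have hin : ContinuousAt (fun e : Space N => inner ℝ x e) e :=
      (by fun_prop : Continuous fun e : Space N => inner ℝ x e).continuousAt
    rcases hx.lt_or_gt with hx | hx
    · have hneg : ∀ i, mirrorDiff e (u i) x < 0 := fun i => by
        have := h.2 i (mirror e x) (S.mirror_mem.2 hxΩ) (by rw [inner_mirror h.1]; linarith)
        rw [mirrorDiff_odd] at this
        linarith
      filter_upwards [hin.eventually_lt_const hx, Filter.eventually_all.2 fun i =>
        (S.continuousAt_mirrorDiff_left i x h.1).eventually_lt_const (hneg i)] with e' h1 h2
      simp only [mem_empty_iff_false, iff_false]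
      rintro ⟨-, i, h3 | h3⟩
      · exact h3.1.not_gt h1
      · exact h3.2.not_gt (h2 i)
    · filter_upwards [hin.eventually_const_lt hx, Filter.eventually_all.2 fun i =>
        (S.continuousAt_mirrorDiff_left i x h.1).eventually_const_lt (h.2 i x hxΩ hx)] with e' h1 h2
      simp only [mem_empty_iff_false, iff_false]
      rintro ⟨-, i, h3 | h3⟩
      · exact h3.2.not_gt (h2 i)
      · exact h3.1.not_gt h1
  · exact Filter.Eventually.of_forall fun _ => ⟨fun h => absurd h.1 hxΩ, fun h => absurd h id⟩

/-- For nearby directions the wrong-sign set is small, so the weak principle gives nonnegativity;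
strictness at one point persists, and the strong principle spreads it. -/
lemma isOpen_dominating [NeZero m] (S : PositiveSolution k₀ Ω f u) : IsOpen (dominating Ω u) := by
  obtain ⟨ε, hε, hW⟩ := S.mirrorDiff_nonneg_of_small
  refine isOpen_iff_mem_nhds.2 fun e he => ?_
  obtain ⟨a, ha, hae⟩ := S.exists_mem_half he.1
  have hin : ContinuousAt (fun e : Space N => inner ℝ a e) e :=
    (by fun_prop : Continuous fun e : Space N => inner ℝ a e).continuousAt
  filter_upwards [isOpen_ne.mem_nhds he.1, (S.tendsto_volume_wrongSign he).eventually_le_const hε,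
    hin.eventually_const_lt hae,
    (S.continuousAt_mirrorDiff_left 0 a he.1).eventually_const_lt (he.2 0 a ha hae)]
    with e' h1 h2 h3 h4
  exact ⟨h1, S.mirrorDiff_pos h1 (hW e' h1 h2) ⟨0, a, h3, h4⟩⟩

/-- The first moment of `u`. -/
noncomputable def moment {N : ℕ} (u : Space N → ℝ) : Space N := ∫ x, u x • x

lemma integrable_moment (S : PositiveSolution k₀ Ω f u) (i : Fin m) :
    Integrable fun x => u i x • x := by
  have hc : HasCompactSupport (u i) :=
    HasCompactSupport.intro S.bdd.isCompact_closure fun x hx =>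
      S.eq_zero i fun h => hx (subset_closure h)
  exact ((S.cont i).smul continuous_id).integrable_of_hasCompactSupport hc.smul_right

/-- Under reflection `⟪x, e⟫` changes sign, so both halves of the difference contribute equally. The
identity links a fixed vector to the differences for every direction at once. -/
lemma inner_moment (S : PositiveSolution k₀ Ω f u) (i : Fin m) (he : e ≠ 0) :
    Integrable (fun x => mirrorDiff e (u i) x * inner ℝ x e) ∧
      2 * inner ℝ (moment (u i)) e = ∫ x, mirrorDiff e (u i) x * inner ℝ x e := by
  have h1 : Integrable fun x => u i x * inner ℝ x e := by
    refine ((S.integrable_moment i).inner_const e).congr (Filter.Eventually.of_forall fun x => ?_)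
    simp [inner_smul_left]
  have h2 : ∫ x, u i x * inner ℝ x e = inner ℝ (moment (u i)) e := by
    rw [real_inner_comm, moment, ← integral_inner (S.integrable_moment i)]
    congr 1; ext x
    rw [inner_smul_right, real_inner_comm]
  have h3 : Integrable fun x => u i (mirror e x) * inner ℝ x e := by
    have := ((mirror e).measurePreserving.integrable_comp_emb
      (mirror e).toHomeomorph.measurableEmbedding).2 h1
    refine this.neg.congr (Filter.Eventually.of_forall fun x => ?_)
    simp only [Pi.neg_apply, Function.comp_apply, inner_mirror he]
    ring
  have h4 : ∫ x, u i (mirror e x) * inner ℝ x e = -∫ x, u i x * inner ℝ x e := by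
    rw [← integral_neg]
    refine Eq.trans ?_ ((mirror e).measurePreserving.integral_comp
      (mirror e).toHomeomorph.measurableEmbedding _)
    congr 1; ext x
    rw [inner_mirror he]; ring
  have h5 : (fun x => mirrorDiff e (u i) x * inner ℝ x e)
      = fun x => u i x * inner ℝ x e - u i (mirror e x) * inner ℝ x e := by
    ext x; rw [mirrorDiff]; ring
  rw [h5]
  refine ⟨h1.sub h3, ?_⟩
  rw [integral_sub h1 h3, h4, h2]
  ring

lemma inner_moment_pos (S : PositiveSolution k₀ Ω f u) (i : Fin m) (h : e ∈ dominating Ω u) :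
    0 < inner ℝ (moment (u i)) e := by
  obtain ⟨hi, heq⟩ := S.inner_moment i h.1
  obtain ⟨a, ha, hae⟩ := S.exists_mem_half h.1
  have hc : Continuous fun x => mirrorDiff e (u i) x * inner ℝ x e :=
    (S.continuous_mirrorDiff i).mul (continuous_inner_left e)
  have hnn : ∀ x, 0 ≤ mirrorDiff e (u i) x * inner ℝ x e := by
    intro x
    rcases lt_trichotomy (inner ℝ x e) 0 with hx | hx | hx
    · have := S.nonneg_of_dominating h i (x := mirror e x) (by rw [inner_mirror h.1]; linarith)
      rw [mirrorDiff_odd] at this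
      exact mul_nonneg_of_nonpos_of_nonpos (by linarith) hx.le
    · rw [hx, mul_zero]
    · exact mul_nonneg (S.nonneg_of_dominating h i hx) hx.le
  have : 0 < ∫ x, mirrorDiff e (u i) x * inner ℝ x e :=
    (integral_pos_iff_support_of_nonneg hnn hi).2
      (hc.isOpen_support.measure_pos _ ⟨a, (mul_pos (h.2 i a ha hae) hae).ne'⟩)
  linarith

/-- The dominating directions form an open half space. -/
lemma mem_dominating_of_inner_moment_pos [NeZero m] (S : PositiveSolution k₀ Ω f u)
    (hne : (dominating Ω u).Nonempty) :
    {e | 0 < inner ℝ (moment (u 0)) e} ⊆ dominating Ω u := by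
  set p := moment (u 0)
  have hconv : IsPreconnected {e : Space N | 0 < inner ℝ p e} :=
    (convex_halfSpace_gt (IsLinearMap.mk (fun x y => inner_add_right p x y)
      fun c x => by simp [inner_smul_right]) 0).isPreconnected
  -- `B` collects the directions where even the weak inequality fails, an open condition. That it
  -- and the dominating directions cover the half space is the closedness part of the continuity
  -- argument.
  set B : Set (Space N) := {e | e ≠ 0 ∧ ∃ i x, 0 < inner ℝ x e ∧ mirrorDiff e (u i) x < 0} with hB
  have hBo : IsOpen B := by
    refine isOpen_iff_mem_nhds.2 ?_
    rintro e ⟨he, i, x, hx, hneg⟩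
    have hin : ContinuousAt (fun e : Space N => inner ℝ x e) e :=
      (by fun_prop : Continuous fun e : Space N => inner ℝ x e).continuousAt
    filter_upwards [isOpen_ne.mem_nhds he, hin.eventually_const_lt hx,
      (S.continuousAt_mirrorDiff_left i x he).eventually_lt_const hneg] with e' h1 h2 h3
    exact ⟨h1, i, x, h2, h3⟩
  refine hconv.subset_left_of_subset_union S.isOpen_dominating hBo ?_ ?_ ?_
  · rw [Set.disjoint_left]
    rintro e he ⟨-, i, x, hx, hneg⟩
    exact (S.nonneg_of_dominating he i hx).not_gt hneg
  · intro e he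
    have he' : 0 < inner ℝ p e := he
    have he0 : e ≠ 0 := by rintro rfl; simp at he'
    by_cases hb : e ∈ B
    · exact Or.inr hb
    left
    have hnn : ∀ i x, 0 < inner ℝ x e → 0 ≤ mirrorDiff e (u i) x := fun i x hx => by
      by_contra! hneg
      exact hb ⟨he0, i, x, hx, hneg⟩
    refine ⟨he0, S.mirrorDiff_pos he0 hnn ?_⟩
    -- Otherwise component `0` would be symmetric along `e`, and its moment in that direction would
    -- vanish.
    by_contra! hzero
    have hz : ∀ x, mirrorDiff e (u 0) x * inner ℝ x e = 0 := by
      have hH : ∀ x, 0 < inner ℝ x e → mirrorDiff e (u 0) x = 0 := fun x hx =>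
        le_antisymm (hzero 0 x hx) (hnn 0 x hx)
      intro x
      rcases lt_trichotomy (inner ℝ x e) 0 with hx | hx | hx
      · have := hH (mirror e x) (by rw [inner_mirror he0]; linarith)
        rw [mirrorDiff_odd, neg_eq_zero] at this
        rw [this, zero_mul]
      · rw [hx, mul_zero]
      · rw [hH x hx, zero_mul]
    have h2 := (S.inner_moment 0 he0).2
    simp only [hz, integral_zero] at h2
    linarith
  · obtain ⟨e, he⟩ := hne
    exact ⟨e, S.inner_moment_pos 0 he, he⟩

/-! ### From dominating directions to foliated symmetry -/

/-- Reflection along `x - y` maps `x` to `y`, because the norms agree, and `⟪x, x - y⟫ = ‖x - y‖ ^ 2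
/ 2 > 0`. -/
lemma lt_of_inner_lt {p : Space N}
    (hp : {e | 0 < inner ℝ p e} ⊆ dominating Ω u) (i : Fin m) {x y : Space N} (hx : x ∈ Ω)
    (hxy : ‖x‖ = ‖y‖) (hlt : inner ℝ y p < inner ℝ x p) : u i y < u i x := by
  have he : x - y ∈ dominating Ω u := hp (by
    change 0 < inner ℝ p (x - y)
    rw [inner_sub_right, real_inner_comm, real_inner_comm y p]
    linarith)
  have hsq : 0 < ‖x - y‖ ^ 2 := by
    have := norm_pos_iff.2 he.1
    positivity
  have hin : 0 < inner ℝ x (x - y) := by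
    rw [norm_sub_sq_real, ← hxy] at hsq
    rw [inner_sub_right, real_inner_self_eq_norm_sq]
    linarith
  have := he.2 i x hx hin
  have hm : mirror (x - y) x = y := Submodule.reflection_sub hxy
  rw [mirrorDiff, hm] at this
  linarith

/-- Now `x - y` lies on the boundary of the half space. A failure of the inequality would persist
for the tilted directions `x - y + t • p` with small `t > 0`, which are dominating. -/
lemma le_of_inner_eq (S : PositiveSolution k₀ Ω f u) {p : Space N} (hp0 : p ≠ 0)
    (hp : {e | 0 < inner ℝ p e} ⊆ dominating Ω u) (i : Fin m) {x y : Space N}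
    (hxy : ‖x‖ = ‖y‖) (heq : inner ℝ y p = inner ℝ x p) : u i y ≤ u i x := by
  by_cases hne : x = y
  · rw [hne]
  have he0 : x - y ≠ 0 := sub_ne_zero.2 hne
  have hsq : 0 < ‖x - y‖ ^ 2 := by
    have := norm_pos_iff.2 he0
    positivity
  have hin : 0 < inner ℝ x (x - y) := by
    rw [norm_sub_sq_real, ← hxy] at hsq
    rw [inner_sub_right, real_inner_self_eq_norm_sq]
    linarith
  have hm : mirror (x - y) x = y := Submodule.reflection_sub hxy
  by_contra! hlt
  have hneg : mirrorDiff (x - y) (u i) x < 0 := by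
    rw [mirrorDiff, hm]; linarith
  have hpath : Filter.Tendsto (fun t : ℝ => x - y + t • p) (nhdsWithin 0 (Ioi 0))
      (nhds (x - y)) := by
    have : Continuous fun t : ℝ => x - y + t • p := by fun_prop
    have h0 := this.tendsto 0
    simp only [zero_smul, add_zero] at h0
    exact h0.mono_left nhdsWithin_le_nhds
  have hc : ContinuousAt (fun e : Space N => inner ℝ x e) (x - y) :=
    (by fun_prop : Continuous fun e : Space N => inner ℝ x e).continuousAt
  have hev := hpath.eventually ((hc.eventually_const_lt hin).and
    ((S.continuousAt_mirrorDiff_left i x he0).eventually_lt_const hneg))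
  obtain ⟨t, ⟨h1, h2⟩, ht⟩ := (hev.and self_mem_nhdsWithin).exists
  have hmem : x - y + t • p ∈ dominating Ω u := hp (by
    change 0 < inner ℝ p (x - y + t • p)
    rw [inner_add_right, inner_sub_right, real_inner_comm, real_inner_comm y p, heq, sub_self,
      zero_add, inner_smul_right, real_inner_self_eq_norm_sq]
    have := norm_pos_iff.2 hp0
    exact mul_pos ht (by positivity))
  exact (S.nonneg_of_dominating hmem i h1).not_gt h2

end PositiveSolution

lemma mirror_single_eq_flipFirst {N : ℕ} [NeZero N] (x : Space N) :
    mirror (EuclideanSpace.single 0 1) x = flipFirst x := by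
  rw [mirror_apply]
  ext j
  by_cases hj : j = 0
  · subst hj
    simp [flipFirst, EuclideanSpace.inner_single_left]
    ring
  · simp [flipFirst, hj]

/-- If a positive solution dominates its reflection `flipFirst`, and strictly so somewhere in the
component `0`, then all components are foliated Schwarz symmetric with a common axis. -/
lemma PositiveSolution.exists_axis {N m : ℕ} [NeZero N] [NeZero m] {k₀ : ℝ → ℝ≥0∞}
    {Ω : Set (Space N)} {f : Fin m → ℝ × (Fin m → ℝ) → ℝ} {u : Fin m → Space N → ℝ}
    (S : PositiveSolution k₀ Ω f u)
    (hdom : ∀ i, ∀ x : Space N, 0 < x 0 → u i (flipFirst x) ≤ u i x)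
    (hdom_strict : ∃ x : Space N, 0 < x 0 ∧ u 0 (flipFirst x) < u 0 x) :
    ∃ p : Space N, ‖p‖ = 1 ∧
      ∀ i, FoliatedSchwarzSymmetric Ω p (u i) ∧ StrictlyDecreasingInPolarAngle Ω p (u i) := by
  have hinner : ∀ x : Space N, inner ℝ x (EuclideanSpace.single 0 1 : Space N) = x 0 := fun x => by
    simp [EuclideanSpace.inner_single_right]
  have hsingle : (EuclideanSpace.single 0 1 : Space N) ≠ 0 := by
    intro h
    have := congrArg norm h
    simp at this
  have hdomin : (EuclideanSpace.single 0 1 : Space N) ∈ PositiveSolution.dominating Ω u := by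
    refine ⟨hsingle, S.mirrorDiff_pos hsingle (fun i x hx => ?_) ?_⟩
    · rw [hinner] at hx
      rw [mirrorDiff, mirror_single_eq_flipFirst]
      exact sub_nonneg.2 (hdom i x hx)
    · obtain ⟨x, hx, hlt⟩ := hdom_strict
      refine ⟨0, x, by rwa [hinner], ?_⟩
      rw [mirrorDiff, mirror_single_eq_flipFirst]
      exact sub_pos.2 hlt
  set q := PositiveSolution.moment (u 0) with hq
  have hq0 : q ≠ 0 := by
    intro h
    have := S.inner_moment_pos 0 hdomin
    rw [← hq, h, inner_zero_left] at this
    exact lt_irrefl _ this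
  have hqn : 0 < ‖q‖ := norm_pos_iff.2 hq0
  set p : Space N := ‖q‖⁻¹ • q with hpdef
  have hpn : ‖p‖ = 1 := by
    rw [hpdef, norm_smul, norm_inv, norm_norm, inv_mul_cancel₀ hqn.ne']
  have hp0 : p ≠ 0 := by
    intro h; rw [h, norm_zero] at hpn; exact zero_ne_one hpn
  have hp : {e | 0 < inner ℝ p e} ⊆ PositiveSolution.dominating Ω u := by
    intro e he
    refine S.mem_dominating_of_inner_moment_pos ⟨_, hdomin⟩ ?_
    have h1 : 0 < inner ℝ p e := he
    rw [hpdef, inner_smul_left] at h1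
    exact pos_of_mul_pos_right h1 (by simp)
  have hsphere : ∀ r : ℝ, 0 < r → r • (EuclideanSpace.single 0 1 : Space N) ∈ Ω →
      ∀ x : Space N, ‖x‖ = r → x ∈ Ω := fun r hr hmem x hx =>
    S.radial _ x (by rw [norm_smul, Real.norm_of_nonneg hr.le, hx]; simp) hmem
  have hcos : ∀ x y : Space N, 0 < ‖x‖ → ‖x‖ = ‖y‖ → InnerProductGeometry.angle x p
      < InnerProductGeometry.angle y p → inner ℝ y p < inner ℝ x p := by
    intro x y hx hxy hlt
    have hc := Real.strictAntiOn_cos ⟨InnerProductGeometry.angle_nonneg _ _,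
      InnerProductGeometry.angle_le_pi _ _⟩ ⟨InnerProductGeometry.angle_nonneg _ _,
      InnerProductGeometry.angle_le_pi _ _⟩ hlt
    rw [← InnerProductGeometry.cos_angle_mul_norm_mul_norm x p,
      ← InnerProductGeometry.cos_angle_mul_norm_mul_norm y p, ← hxy, hpn, mul_one]
    exact mul_lt_mul_of_pos_right hc hx
  have hstrict : ∀ i, StrictlyDecreasingInPolarAngle Ω p (u i) := by
    intro i r hr hmem x y hx hy hlt
    exact PositiveSolution.lt_of_inner_lt hp i (hsphere r hr hmem x hx) (hx.trans hy.symm)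
      (hcos x y (hx ▸ hr) (hx.trans hy.symm) hlt)
  refine ⟨p, hpn, fun i => ⟨?_, hstrict i⟩⟩
  intro r hr hmem c
  have hmono : ∀ x y : Space N, ‖x‖ = r → ‖y‖ = r → InnerProductGeometry.angle x p
      ≤ InnerProductGeometry.angle y p → u i y ≤ u i x := by
    intro x y hx hy hle
    rcases hle.lt_or_eq with hlt | heq
    · exact (hstrict i r hr hmem x y hx hy hlt).le
    · refine S.le_of_inner_eq hp0 hp i (hx.trans hy.symm) ?_
      rw [← InnerProductGeometry.cos_angle_mul_norm_mul_norm x p,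
        ← InnerProductGeometry.cos_angle_mul_norm_mul_norm y p, heq, hx, hy]
  -- The full sphere needs no separate case, being a geodesic ball itself.
  right
  rcases Set.eq_empty_or_nonempty {x : Space N | ‖x‖ = r ∧ c ≤ u i x} with hemp | hnon
  · exact Or.inl hemp
  right
  have hcomp : IsCompact {x : Space N | ‖x‖ = r ∧ c ≤ u i x} := by
    refine (isCompact_sphere (0 : Space N) r).of_isClosed_subset
      ((isClosed_eq continuous_norm continuous_const).inter
        (isClosed_le continuous_const (S.cont i))) fun x hx => ?_
    simpa using hx.1
  have hangle : ContinuousOn (fun x : Space N => InnerProductGeometry.angle x p)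
      {x : Space N | ‖x‖ = r ∧ c ≤ u i x} := by
    intro x hx
    have hx0 : x ≠ 0 := by
      rintro rfl
      exact hr.ne (norm_zero.symm.trans hx.1)
    have h1 : ContinuousAt (fun y : Space N × Space N => InnerProductGeometry.angle y.1 y.2)
      (x, p) := InnerProductGeometry.continuousAt_angle hx0 hp0
    exact (h1.comp (f := fun x : Space N => (x, p))
      (continuousAt_id.prodMk continuousAt_const)).continuousWithinAt
  -- The point of the superlevel set with the largest polar angle determines the radius.
  obtain ⟨y, hy, hmax⟩ := hcomp.exists_isMaxOn hnon hangle
  refine ⟨r * InnerProductGeometry.angle y p,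
    mul_nonneg hr.le (InnerProductGeometry.angle_nonneg _ _), ?_⟩
  ext x
  simp only [geodesicBall, Set.mem_ofPred_eq, InnerProductGeometry.angle_smul_right_of_pos x p hr]
  constructor
  · rintro ⟨hx, hcx⟩
    exact ⟨hx, mul_le_mul_of_nonneg_left (hmax ⟨hx, hcx⟩) hr.le⟩
  · rintro ⟨hx, hle⟩
    exact ⟨hx, hy.2.trans (hmono x y hx hy.1 (le_of_mul_le_mul_left hle hr))⟩

end FoliatedSystems

theorem theorem1p2 {N m : ℕ} [NeZero N] [NeZero m] (hN : 2 ≤ N)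
    (k₀ : ℝ → ℝ≥0∞) (hk : FoliatedSystems.IsKernelProfile N k₀)
    (Ω : Set (EuclideanSpace ℝ (Fin N)))
    (hΩ_open : IsOpen Ω) (hΩ_conn : IsConnected Ω)
    (hΩ_bdd : Bornology.IsBounded Ω) (hΩ_rad : FoliatedSystems.IsRadial Ω)
    (f : Fin m → ℝ × (Fin m → ℝ) → ℝ)
    (hf : ∀ i, ContDiffOn ℝ 1 (f i) (Ici (0 : ℝ) ×ˢ (univ : Set (Fin m → ℝ))))
    (hcoop : ∀ i j : Fin m, i ≠ j → ∀ (r : ℝ) (v : Fin m → ℝ), 0 < r → (∀ l, 0 < v l) →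
      0 < FoliatedSystems.partialU (f j) i r v)
    (u : Fin m → EuclideanSpace ℝ (Fin N) → ℝ)
    (hu_cont : ∀ i, Continuous (u i))
    (hu_bdd : ∀ i, ∃ C : ℝ, ∀ x, |u i x| ≤ C)
    (hu_sol : FoliatedSystems.IsWeakSolution k₀ Ω f u)
    (hu_pos : ∀ i, ∀ x ∈ Ω, 0 < u i x)
    (hdom : ∀ i, ∀ x : EuclideanSpace ℝ (Fin N), 0 < x 0 →
      u i (FoliatedSystems.flipFirst x) ≤ u i x)
    (hdom_strict : ∃ x : EuclideanSpace ℝ (Fin N), 0 < x 0 ∧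
      u 0 (FoliatedSystems.flipFirst x) < u 0 x) :
    ∃ p : EuclideanSpace ℝ (Fin N), ‖p‖ = 1 ∧
      ∀ i, FoliatedSystems.FoliatedSchwarzSymmetric Ω p (u i) ∧
        FoliatedSystems.StrictlyDecreasingInPolarAngle Ω p (u i) := by
  exact FoliatedSystems.PositiveSolution.exists_axis
    ⟨hk, hΩ_open, hΩ_conn, hΩ_bdd, hΩ_rad, hf, hcoop, hu_cont, hu_bdd, hu_sol, hu_pos⟩
    hdom hdom_strict
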